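/- **Setting.** Let $\mathcal D$ be the space of complex-valued test functions on $\mathbb R$ and $\mathcal D'$ its dual. A distribution is *regular* if it is given by a locally integrable function; the *order* $\operatorname{ord}F$ of $F\in\mathcal D'$ is the least $n\ge 0$ such that $F$ is the $n$-th distributional derivative of a regular distribution. Let $\mathcal C_p^\infty$ be the space of functions that are smooth off a finite set, at each point of which they and all their derivatives have finite left and right limits; let $\mathcal A\subset\mathcal D'$ consist of the elements of $\mathcal C_p^\infty$, regarded as distributions, and all their distributional derivatives. For $F,G\in\mathcal A$ put $$F*G=\lim_{\epsilon\downarrow 0}F(x)\cdot G(x+\epsilon)\quad\text{in }\mathcal D',$$ where $\cdot$ is the Hörmander product of distributions with disjoint singular supports (locally one of the two factors is a smooth function, and $\cdot$ is the usual product of a distribution by a smooth function). Let $a_0,a_1,b_0,b_1\in\mathcal A$, $w\in\mathbb C$, and consider the equation $$\sum_{i=0}^{2}\binom 2i\left(a_0^{(i)}*\phi^{(4-i)}+\phi^{(4-i)}*a_1^{(i)}\right)-w^2\left(b_0*\phi+\phi*b_1\right)=0 ,\qquad (E)$$ a solution being a $\phi\in\mathcal A$ that satisfies $(E)$ in $\mathcal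 D'$. Let $I$ be the singular set of $(E)$, i.e. the union of the singular supports of its coefficients $a_j^{(i)}$ ($0\le i\le 2$) and $w^2b_j$, $j=0,1$. **Corollary.** Assume that - (C1') $a_0(\xi^-)+a_1(\xi^+)\neq 0$ for all $\xi\in I$; - (C2') for every open interval $\Omega\subseteq\mathbb R$ with $\Omega\cap I=\emptyset$, $a_{0\overline\Omega}(x)+a_{1\overline\Omega}(x)\neq0$ for all $x\in\overline\Omega$, where $a_{i\overline\Omega}\in\mathcal C^\infty(\overline\Omega)$ denotes the smooth extension of $a_i|_\Omega$ to $\overline\Omega$. Let $M=\max\{\operatorname{ord}a_0'',\operatorname{ord}a_1'',\operatorname{ord}b_0,\operatorname{ord}b_1\}$. Then: 1. if $M\le4$, every solution $\phi$ of $(E)$ satisfies $\operatorname{ord}\phi=0$ and $\phi\in\mathcal C_p^\infty$; 2. if $M>4$, every solution $\phi$ of $(E)$ satisfies $\operatorname{ord}\phi\le M-4$. -/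

import Mathlib

open Set Filter Topology MeasureTheory TopologicalSpace
open scoped Distributions ContDiff

namespace BeamODE

/-- The space `𝓓` of complex-valued smooth functions on `ℝ` with compact support. -/
abbrev Test : Type := 𝓓((⊤ : Opens ℝ), ℂ)

/-- The space `𝓓'` of (complex) Schwartz distributions on `ℝ`: continuous `ℂ`-linear functionals
on `𝓓`, which carries its canonical LF topology. -/
abbrev Distr : Type := Test →L[ℂ] ℂ

noncomputable section

/-- The distributional derivative, `⟨F', t⟩ = -⟨F, t'⟩`. -/
def D (F : Distr) : Distr :=
  -(F.comp (TestFunction.lineDerivCLM ℂ (1 : ℝ) : Test →L[ℂ] Test))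

theorem D_apply (F : Distr) (t s : Test) (hs : ∀ x, s x = deriv t x) : D F t = -F s := by
  have h : (TestFunction.lineDerivCLM ℂ (1 : ℝ) t : Test) = s := by
    ext x
    rw [TestFunction.lineDerivCLM_apply_of_le (by simp), hs, lineDeriv]
    have := deriv_comp_const_add (f := (t : ℝ → ℂ)) (a := x) (x := 0)
    simpa using this
  simp [D, h]

/-- The distribution `t ↦ ∫ f t` of a locally integrable function `f`
(and `0` if `f` is not locally integrable). -/
def ofFun (f : ℝ → ℂ) : Distr :=
  TestFunction.integralAgainstBilinCLM (ContinuousLinearMap.mul ℂ ℂ) volume f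

theorem ofFun_apply (f : ℝ → ℂ) (hf : LocallyIntegrable f volume) (t : Test) :
    ofFun f t = ∫ x, f x * t x := by
  have h : LocallyIntegrableOn f ((⊤ : Opens ℝ) : Set ℝ) volume := by
    simpa [locallyIntegrableOn_univ] using hf
  rw [ofFun, TestFunction.integralAgainstBilinCLM_eq_integral h]
  simp [mul_comm]

/-- Regular distributions: those given by a locally integrable function. -/
def IsRegular (F : Distr) : Prop :=
  ∃ f : ℝ → ℂ, LocallyIntegrable f volume ∧ F = ofFun f

/-- The order of `F`: the least `n` such that `F` is the `n`-th distributional derivative of a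
regular distribution (and `⊤` if there is no such `n`). -/
def ord (F : Distr) : ℕ∞ :=
  sInf {m : ℕ∞ | ∃ n : ℕ, m = n ∧ ∃ R : Distr, IsRegular R ∧ F = D^[n] R}

/-- `f` is smooth off a finite set, at each point of which `f` and all its derivatives have finite
left and right limits. -/
def IsPiecewiseSmooth (f : ℝ → ℂ) : Prop :=
  ∃ S : Set ℝ, S.Finite ∧ ContDiffOn ℝ ∞ f Sᶜ ∧
    ∀ x ∈ S, ∀ n : ℕ,
      (∃ l, Tendsto (iteratedDeriv n f) (𝓝[<] x) (𝓝 l)) ∧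
      (∃ r, Tendsto (iteratedDeriv n f) (𝓝[>] x) (𝓝 r))

/-- The piecewise smooth functions `C_p^∞`, regarded as distributions. -/
def Cp : Set Distr := {F | ∃ f : ℝ → ℂ, IsPiecewiseSmooth f ∧ F = ofFun f}

/-- The space `𝒜`: elements of `C_p^∞` together with all their distributional derivatives. -/
def A : Set Distr := {F | ∃ G ∈ Cp, ∃ n : ℕ, F = D^[n] G}

/-- On the open set `U` the distribution `F` is the smooth function `g`
(only the values of `g` on `U` matter). -/
def IsSmoothFunOn (F : Distr) (g : ℝ → ℂ) (U : Opens ℝ) : Prop :=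
  ContDiffOn ℝ ∞ g U ∧ ∀ t : Test, tsupport t ⊆ U → F t = ∫ x, g x * t x

/-- The singular support: the complement of the largest open set where `F` is a smooth function. -/
def singSupp (F : Distr) : Set ℝ :=
  (⋃ U ∈ {U : Opens ℝ | ∃ g, IsSmoothFunOn F g U}, (U : Set ℝ))ᶜ

/-- The test function `g t`, for `g` smooth on `U` and `t` supported in `U`. -/
def mulTest (U : Opens ℝ) (g : ℝ → ℂ) (hg : ContDiffOn ℝ ∞ g U) (t : Test)
    (ht : tsupport t ⊆ U) : Test where
  toFun x := g x * t x
  contDiff' := by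
    refine contDiff_iff_contDiffAt.2 fun x => ?_
    by_cases hx : x ∈ tsupport t
    · exact (hg.contDiffAt (U.isOpen.mem_nhds (ht hx))).mul t.contDiff.contDiffAt
    · have h0 : (fun y => g y * t y) =ᶠ[𝓝 x] fun _ => 0 := by
        filter_upwards [(isClosed_tsupport t).isOpen_compl.mem_nhds hx] with y hy
        rw [image_eq_zero_of_notMem_tsupport hy, mul_zero]
      exact contDiffAt_const.congr_of_eventuallyEq h0
  hasCompactSupport' := t.hasCompactSupport.mul_left
  tsupport_subset' := by simp

/-- On `U`, the distribution `P` is the dual product of `F` by the smooth function `g`, i.e.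
`⟨P, t⟩ = ⟨F, g t⟩` for all test functions `t` supported in `U`. -/
def IsDualProdOn (P F : Distr) (g : ℝ → ℂ) (U : Opens ℝ) : Prop :=
  ∃ hg : ContDiffOn ℝ ∞ g U, ∀ (t : Test) (ht : tsupport t ⊆ U), P t = F (mulTest U g hg t ht)

/-- `P` is the Hörmander product `F · G`: there is a finite open cover of `ℝ` such that on each of
its members one of `F`, `G` is a smooth function and `P` is the dual product of the other factor by
that function. Such a `P` is unique. -/
def IsHormanderProd (F G P : Distr) : Prop :=
  ∃ (d : ℕ) (U : Fin d → Opens ℝ), (⋃ i, (U i : Set ℝ)) = univ ∧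
    ∀ i, (∃ g, IsSmoothFunOn G g (U i) ∧ IsDualProdOn P F g (U i)) ∨
         (∃ f, IsSmoothFunOn F f (U i) ∧ IsDualProdOn P G f (U i))

open Classical in
/-- The Hörmander product `F · G` (and `0` if it does not exist). -/
def hormanderProd (F G : Distr) : Distr :=
  if h : ∃ P, IsHormanderProd F G P then h.choose else 0

/-- Translation of test functions, `t ↦ t(· - ε)`. -/
def translateTest (ε : ℝ) : Test →L[ℂ] Test :=
  TestFunction.limitCLM ℂ
    (fun t : Test => (⟨fun x => t (x - ε), t.contDiff.comp (contDiff_id.sub contDiff_const),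
      t.hasCompactSupport.comp_homeomorph (Homeomorph.subRight ε), by simp⟩ : Test))
    (fun K hK =>
      (TestFunction.ofSupportedInCLM ℂ
        (K := K.map (fun x => x + ε) (by fun_prop)) (Ω := ⊤) (by simp)).comp
      (ContDiffMapSupportedIn.mkCLM ℂ (fun t x => t (x - ε))
        (by intros; rfl) (by intros; rfl)
        (fun t => t.contDiff.comp (contDiff_id.sub contDiff_const))
        (fun t x hx => by
          refine t.zero_on_compl fun h => hx ?_
          exact ⟨x - ε, h, by simp⟩)
        (fun i _ => ⟨{i}, 1, zero_le_one, fun t x _ => by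
          rw [iteratedFDeriv_comp_sub]
          simpa using ContDiffMapSupportedIn.norm_iteratedFDeriv_apply_le_seminorm_top ℂ⟩)))
    (fun K hK t => rfl)

/-- The translate `G(x + ε)` of the distribution `G(x)`: `⟨G(x + ε), t(x)⟩ = ⟨G(x), t(x - ε)⟩`. -/
def translate (ε : ℝ) (G : Distr) : Distr := G.comp (translateTest ε)

/-- `P = lim_{ε ↓ 0} F(x) · G(x + ε)`, the limit being taken in the distributional sense. -/
def IsStarProd (F G P : Distr) : Prop :=
  ∀ t : Test, Tendsto (fun ε => hormanderProd F (translate ε G) t) (𝓝[>] (0 : ℝ)) (𝓝 (P t))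

open Classical in
/-- The product `F * G = lim_{ε ↓ 0} F(x) · G(x + ε)` (and `0` if the limit does not exist, which
never happens for `F, G ∈ 𝒜`). -/
def starProd (F G : Distr) : Distr :=
  if h : ∃ P, IsStarProd F G P then h.choose else 0

/-- The operator
`∑_{i=0}^{2} (2 choose i) (a₀⁽ⁱ⁾ * φ⁽⁴⁻ⁱ⁾ + φ⁽⁴⁻ⁱ⁾ * a₁⁽ⁱ⁾) - w² (b₀ * φ + φ * b₁)`. -/
def eigenOp (a₀ a₁ b₀ b₁ : Distr) (w : ℂ) (φ : Distr) : Distr :=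
  ∑ i ∈ Finset.range 3, (Nat.choose 2 i : ℂ) •
      (starProd (D^[i] a₀) (D^[4 - i] φ) + starProd (D^[4 - i] φ) (D^[i] a₁))
    - w ^ 2 • (starProd b₀ φ + starProd φ b₁)

/-- `φ` is a solution of the eigenvalue equation: `φ ∈ 𝒜` and the equation holds in `𝓓'`. -/
def IsSolution (a₀ a₁ b₀ b₁ : Distr) (w : ℂ) (φ : Distr) : Prop :=
  φ ∈ A ∧ eigenOp a₀ a₁ b₀ b₁ w φ = 0

/-- The singular set of the equation: the union of the singular supports of its coefficients
(up to nonzero factors these are `a₀⁽ⁱ⁾`, `a₁⁽ⁱ⁾` for `i ≤ 2`, and `w² b₀`, `w² b₁`). -/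
def singularSet (a₀ a₁ b₀ b₁ : Distr) (w : ℂ) : Set ℝ :=
  (⋃ i ∈ Finset.range 3, (singSupp (D^[i] a₀) ∪ singSupp (D^[i] a₁))) ∪
    (singSupp (w ^ 2 • b₀) ∪ singSupp (w ^ 2 • b₁))

/-- `F(x⁻) = v`: just to the left of `x`, `F` is a smooth function which tends to `v` at `x`. -/
def HasLeftValue (F : Distr) (x : ℝ) (v : ℂ) : Prop :=
  ∃ δ > 0, ∃ f, IsSmoothFunOn F f ⟨Ioo (x - δ) x, isOpen_Ioo⟩ ∧ Tendsto f (𝓝[<] x) (𝓝 v)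

/-- `F(x⁺) = v`: just to the right of `x`, `F` is a smooth function which tends to `v` at `x`. -/
def HasRightValue (F : Distr) (x : ℝ) (v : ℂ) : Prop :=
  ∃ δ > 0, ∃ f, IsSmoothFunOn F f ⟨Ioo x (x + δ), isOpen_Ioo⟩ ∧ Tendsto f (𝓝[>] x) (𝓝 v)

/-- `g` is a `C^∞(closure U)`-extension of the restriction of `F` to `U`. -/
def IsSmoothExt (F : Distr) (U : Opens ℝ) (g : ℝ → ℂ) : Prop :=
  IsSmoothFunOn F g U ∧ ContDiffOn ℝ ∞ g (closure (U : Set ℝ))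

/-- `a₀(ξ⁻) + a₁(ξ⁺) ≠ 0` for all `ξ ∈ I`. -/
def CondC1 (a₀ a₁ : Distr) (I : Set ℝ) : Prop :=
  ∀ ξ ∈ I, ∀ v₀ v₁ : ℂ, HasLeftValue a₀ ξ v₀ → HasRightValue a₁ ξ v₁ → v₀ + v₁ ≠ 0

/-- For every open interval `U` without singular points, the sum of the smooth extensions of
`a₀` and `a₁` from `U` to the closure of `U` has no zero there. -/
def CondC2 (a₀ a₁ : Distr) (I : Set ℝ) : Prop :=
  ∀ U : Opens ℝ, (U : Set ℝ).OrdConnected → Disjoint (U : Set ℝ) I →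
    ∀ g₀ g₁ : ℝ → ℂ, IsSmoothExt a₀ U g₀ → IsSmoothExt a₁ U g₁ →
      ∀ x ∈ closure (U : Set ℝ), g₀ x + g₁ x ≠ 0

/-- The maximal order of `a₀''`, `a₁''`, `b₀`, `b₁`. -/
def maxOrd (a₀ a₁ b₀ b₁ : Distr) : ℕ∞ :=
  max (max (ord (D^[2] a₀)) (ord (D^[2] a₁))) (max (ord b₀) (ord b₁))

end

end BeamODE

open BeamODE

/-!
The elements of `𝒜` are the sums of a piecewise smooth function and finitely many point masses
`δ_ξ⁽ᵏ⁾`. For `F = f + ∑ c ξ k • δ_ξ⁽ᵏ⁾` and `G = g + ∑ d η k • δ_η⁽ᵏ⁾` the Hörmander product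
`F(x) · G(x + ε)` is explicit for small `ε > 0`, and its limit is (`isStarProd_limitProd`)
`F * G = f g + ∑ c ξ k • δ_ξ⁽ᵏ⁾ g(ξ⁺) + ∑ d η k • δ_η⁽ᵏ⁾ f(η⁻)`,
where a point mass times a one-sided jet is expanded by Leibniz' rule (`deltaProd`).

Take a solution `φ` and write it as the `n`-th derivative of a piecewise smooth `g`, with `n`
minimal. If `n ≥ 1`, then `g` has a jump `J ≠ 0` at some point `ξ`, as otherwise `g'` is
piecewise smooth without point masses and `n` could be lowered. Then `φ⁗` has the leading point
mass `J δ_ξ⁽ⁿ⁺³⁾`, which contributes `J (a₀(ξ⁻) + a₁(ξ⁺)) δ_ξ⁽ⁿ⁺³⁾` to the equation. The lower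
derivatives of `φ` have lower order, and the point masses of a coefficient of order at most `M`
are of the form `δ_ξ⁽ᵏ⁾` with `k < M`. If `M ≤ n + 3`, nothing else contributes in order `n + 3`,
so `J (a₀(ξ⁻) + a₁(ξ⁺)) = 0`, contradicting the nondegeneracy conditions
(`jump_eq_zero_of_isSolution`). Hence `n = 0` or `n ≤ M - 4`.

Coefficients of leading point masses are read off by testing with functions that shrink to `ξ`
(`HasCoeff`). This gives at once their linearity and uniqueness and the fact that the `n`-th
derivative of a locally integrable function has no point mass `δ_ξ⁽ᵏ⁾` with `k ≥ n`, which links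
the order of a distribution to its point masses (`IsRep.coeff_eq_zero_of_ord_le`).
-/

namespace BeamODE

noncomputable section

/-! ### Functions with finitely many discontinuities -/

/-- `f` is continuous off the finite set `S` and has finite one-sided limits everywhere.
Its values on `S` are arbitrary. -/
structure IsRegulated (S : Finset ℝ) (f : ℝ → ℂ) : Prop where
  continuousOn : ContinuousOn f (S : Set ℝ)ᶜ
  left : ∀ x, ∃ l, Tendsto f (𝓝[<] x) (𝓝 l)
  right : ∀ x, ∃ r, Tendsto f (𝓝[>] x) (𝓝 r)

namespace IsRegulated

variable {S T : Finset ℝ} {f g : ℝ → ℂ}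

theorem isOpen_compl (S : Finset ℝ) : IsOpen (S : Set ℝ)ᶜ :=
  S.finite_toSet.isClosed.isOpen_compl

theorem continuousAt (hf : IsRegulated S f) {x : ℝ} (hx : x ∉ S) : ContinuousAt f x :=
  hf.continuousOn.continuousAt ((isOpen_compl S).mem_nhds (by simpa using hx))

theorem mono (hf : IsRegulated S f) (h : S ⊆ T) : IsRegulated T f :=
  ⟨hf.continuousOn.mono (compl_subset_compl.2 (by exact_mod_cast h)), hf.left, hf.right⟩

theorem mul (hf : IsRegulated S f) (hg : IsRegulated T g) :
    IsRegulated (S ∪ T) (fun x => f x * g x) where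
  continuousOn := (hf.mono Finset.subset_union_left).continuousOn.mul
    (hg.mono Finset.subset_union_right).continuousOn
  left x := by
    obtain ⟨l, hl⟩ := hf.left x
    obtain ⟨m, hm⟩ := hg.left x
    exact ⟨_, hl.mul hm⟩
  right x := by
    obtain ⟨l, hl⟩ := hf.right x
    obtain ⟨m, hm⟩ := hg.right x
    exact ⟨_, hl.mul hm⟩

theorem tendsto_add_const_nhdsLT (x ε : ℝ) :
    Tendsto (fun y => y + ε) (𝓝[<] x) (𝓝[<] (x + ε)) :=
  tendsto_nhdsWithin_iff.2 ⟨((continuous_id.add continuous_const).tendsto x).mono_left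
    nhdsWithin_le_nhds, by
      filter_upwards [self_mem_nhdsWithin] with y hy
      exact add_lt_add_left (mem_Iio.1 hy) ε⟩

theorem tendsto_add_const_nhdsGT (x ε : ℝ) :
    Tendsto (fun y => y + ε) (𝓝[>] x) (𝓝[>] (x + ε)) :=
  tendsto_nhdsWithin_iff.2 ⟨((continuous_id.add continuous_const).tendsto x).mono_left
    nhdsWithin_le_nhds, by
      filter_upwards [self_mem_nhdsWithin] with y hy
      exact add_lt_add_left (mem_Ioi.1 hy) ε⟩

theorem comp_add_const (hf : IsRegulated S f) (ε : ℝ) :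
    IsRegulated (S.image (· - ε)) (fun x => f (x + ε)) where
  continuousOn := by
    refine hf.continuousOn.comp (by fun_prop) fun x hx hxS => hx ?_
    simpa using ⟨x + ε, hxS, by ring⟩
  left x := by
    obtain ⟨l, hl⟩ := hf.left (x + ε)
    exact ⟨l, hl.comp (tendsto_add_const_nhdsLT x ε)⟩
  right x := by
    obtain ⟨l, hl⟩ := hf.right (x + ε)
    exact ⟨l, hl.comp (tendsto_add_const_nhdsGT x ε)⟩

theorem exists_bound (hf : IsRegulated S f) {K : Set ℝ} (hK : IsCompact K) :
    ∃ C, ∀ x ∈ K, ‖f x‖ ≤ C := by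
  refine hK.induction_on (p := fun K => ∃ C, ∀ x ∈ K, ‖f x‖ ≤ C) ⟨0, by simp⟩ ?_ ?_ ?_
  · rintro s t hst ⟨C, hC⟩
    exact ⟨C, fun x hx => hC x (hst hx)⟩
  · rintro s t ⟨C, hC⟩ ⟨C', hC'⟩
    refine ⟨max C C', fun x hx => ?_⟩
    rcases hx with hx | hx
    · exact (hC x hx).trans (le_max_left _ _)
    · exact (hC' x hx).trans (le_max_right _ _)
  · intro x _
    obtain ⟨l, hl⟩ := hf.left x
    obtain ⟨r, hr⟩ := hf.right x
    have h1 := hl.norm.eventually_le_const (lt_add_one ‖l‖)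
    have h2 := hr.norm.eventually_le_const (lt_add_one ‖r‖)
    have h3 : ∀ᶠ y in 𝓝[≠] x, ‖f y‖ ≤ max (max (‖l‖ + 1) (‖r‖ + 1)) ‖f x‖ := by
      rw [punctured_nhds_eq_nhdsWithin_sup_nhdsWithin, eventually_sup]
      constructor
      · filter_upwards [h1] with y hy using hy.trans (by simp)
      · filter_upwards [h2] with y hy using hy.trans (by simp)
    rw [eventually_nhdsWithin_iff] at h3
    refine ⟨_, mem_nhdsWithin_of_mem_nhds h3, max (max (‖l‖ + 1) (‖r‖ + 1)) ‖f x‖, ?_⟩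
    intro y hy
    by_cases hyx : y = x
    · subst hyx; simp
    · exact hy hyx

theorem aestronglyMeasurable (hf : IsRegulated S f) : AEStronglyMeasurable f volume := by
  have h := hf.continuousOn.aestronglyMeasurable (μ := volume) (isOpen_compl S).measurableSet
  rwa [Measure.restrict_eq_self_of_ae_mem] at h
  exact compl_mem_ae_iff.2 (S.finite_toSet.measure_zero _)

theorem locallyIntegrable (hf : IsRegulated S f) : LocallyIntegrable f volume := by
  rw [locallyIntegrable_iff]
  intro K hK
  obtain ⟨C, hC⟩ := hf.exists_bound hK
  exact Measure.integrableOn_of_bounded hK.measure_lt_top.ne hf.aestronglyMeasurable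
    (M := C) ((ae_restrict_iff' hK.measurableSet).2 (ae_of_all _ hC))

end IsRegulated

/-! ### Piecewise smooth functions and their one-sided jets -/

/-- `f` is smooth off the finite set `S`, and `f` and all its derivatives have finite one-sided
limits everywhere. -/
structure IsSmoothOff (S : Finset ℝ) (f : ℝ → ℂ) : Prop where
  contDiffOn : ContDiffOn ℝ ∞ f (S : Set ℝ)ᶜ
  regulated : ∀ n, IsRegulated S (iteratedDeriv n f)

/-- The left limit of the `n`-th derivative of `f` at `x`. -/
def leftJet (f : ℝ → ℂ) (x : ℝ) (n : ℕ) : ℂ := limUnder (𝓝[<] x) (iteratedDeriv n f)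

/-- The right limit of the `n`-th derivative of `f` at `x`. -/
def rightJet (f : ℝ → ℂ) (x : ℝ) (n : ℕ) : ℂ := limUnder (𝓝[>] x) (iteratedDeriv n f)

/-- The jump `f(x⁺) - f(x⁻)`. -/
def jump (f : ℝ → ℂ) (x : ℝ) : ℂ := rightJet f x 0 - leftJet f x 0

theorem contDiffAt_of_contDiffOn_isOpen {f : ℝ → ℂ} {U : Set ℝ} (hU : IsOpen U)
    (hf : ContDiffOn ℝ ∞ f U) {x : ℝ} (hx : x ∈ U) (n : ℕ) : ContDiffAt ℝ n f x :=
  (hf.contDiffAt (hU.mem_nhds hx)).of_le (by exact_mod_cast le_top)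

theorem continuousOn_iteratedDeriv {f : ℝ → ℂ} {U : Set ℝ} (hU : IsOpen U)
    (hf : ContDiffOn ℝ ∞ f U) (n : ℕ) : ContinuousOn (iteratedDeriv n f) U := by
  refine ContinuousOn.congr (hf.continuousOn_iteratedDerivWithin (m := n) ?_ hU.uniqueDiffOn)
    fun x hx => (iteratedDerivWithin_of_isOpen hU hx).symm
  exact_mod_cast le_top

namespace IsSmoothOff

variable {S T : Finset ℝ} {f g : ℝ → ℂ}

theorem mono (hf : IsSmoothOff S f) (h : S ⊆ T) : IsSmoothOff T f :=
  ⟨hf.contDiffOn.mono (compl_subset_compl.2 (by exact_mod_cast h)),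
    fun n => (hf.regulated n).mono h⟩

theorem regulated_zero (hf : IsSmoothOff S f) : IsRegulated S f := by
  simpa using hf.regulated 0

theorem tendsto_leftJet (hf : IsSmoothOff S f) (x : ℝ) (n : ℕ) :
    Tendsto (iteratedDeriv n f) (𝓝[<] x) (𝓝 (leftJet f x n)) :=
  tendsto_nhds_limUnder ((hf.regulated n).left x)

theorem tendsto_rightJet (hf : IsSmoothOff S f) (x : ℝ) (n : ℕ) :
    Tendsto (iteratedDeriv n f) (𝓝[>] x) (𝓝 (rightJet f x n)) :=
  tendsto_nhds_limUnder ((hf.regulated n).right x)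

theorem tendsto_leftJet_zero (hf : IsSmoothOff S f) (x : ℝ) :
    Tendsto f (𝓝[<] x) (𝓝 (leftJet f x 0)) := by
  simpa using hf.tendsto_leftJet x 0

theorem tendsto_rightJet_zero (hf : IsSmoothOff S f) (x : ℝ) :
    Tendsto f (𝓝[>] x) (𝓝 (rightJet f x 0)) := by
  simpa using hf.tendsto_rightJet x 0

theorem deriv (hf : IsSmoothOff S f) : IsSmoothOff S (deriv f) where
  contDiffOn := hf.contDiffOn.deriv_of_isOpen (IsRegulated.isOpen_compl S) (by simp)
  regulated n := by simpa only [iteratedDeriv_succ'] using hf.regulated (n + 1)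

theorem hasDerivAt (hf : IsSmoothOff S f) {x : ℝ} (hx : x ∉ S) :
    HasDerivAt f (_root_.deriv f x) x := by
  have hx' : x ∈ (S : Set ℝ)ᶜ := by simpa using hx
  exact ((contDiffAt_of_contDiffOn_isOpen (IsRegulated.isOpen_compl S) hf.contDiffOn hx'
    1).differentiableAt (by simp)).hasDerivAt

theorem isPiecewiseSmooth (hf : IsSmoothOff S f) : IsPiecewiseSmooth f :=
  ⟨S, S.finite_toSet, hf.contDiffOn, fun x _ n => ⟨(hf.regulated n).left x,
    (hf.regulated n).right x⟩⟩

end IsSmoothOff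

theorem IsPiecewiseSmooth.exists_isSmoothOff {f : ℝ → ℂ} (hf : IsPiecewiseSmooth f) :
    ∃ S : Finset ℝ, IsSmoothOff S f := by
  obtain ⟨S, hS, hf, hlim⟩ := hf
  refine ⟨hS.toFinset, by simpa using hf, fun n => ?_⟩
  have hc : ContinuousOn (iteratedDeriv n f) Sᶜ :=
    continuousOn_iteratedDeriv hS.isClosed.isOpen_compl hf n
  have hx' : ∀ x ∉ S, ContinuousAt (iteratedDeriv n f) x := fun x hx =>
    hc.continuousAt (hS.isClosed.isOpen_compl.mem_nhds hx)
  refine ⟨by simpa using hc, fun x => ?_, fun x => ?_⟩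
  · by_cases hx : x ∈ S
    · exact (hlim x hx n).1
    · exact ⟨_, (hx' x hx).tendsto.mono_left nhdsWithin_le_nhds⟩
  · by_cases hx : x ∈ S
    · exact (hlim x hx n).2
    · exact ⟨_, (hx' x hx).tendsto.mono_left nhdsWithin_le_nhds⟩

/-! ### Distributional derivatives of piecewise smooth functions -/

theorem D_add (F G : Distr) : D (F + G) = D F + D G := by
  simp [D, add_comm]

theorem D_smul (c : ℂ) (F : Distr) : D (c • F) = c • D F := by
  simp [D]

theorem D_sub (F G : Distr) : D (F - G) = D F - D G := by
  simp [D]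
  abel

theorem D_sum {ι : Type*} (s : Finset ι) (F : ι → Distr) : D (∑ i ∈ s, F i) = ∑ i ∈ s, D (F i) := by
  induction s using Finset.cons_induction with
  | empty => simp [D]
  | cons a s ha ih => simp [Finset.sum_cons, D_add, ih]

theorem contDiff_test (t : Test) (n : ℕ) : ContDiff ℝ n t :=
  t.contDiff.of_le (by exact_mod_cast le_top)

/-- The derivative of a test function. -/
def derivTest (t : Test) : Test where
  toFun := deriv t
  contDiff' := (contDiff_infty_iff_deriv.1 t.contDiff).2
  hasCompactSupport' := t.hasCompactSupport.deriv
  tsupport_subset' := by simp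

@[simp] theorem derivTest_apply (t : Test) (x : ℝ) : derivTest t x = deriv t x := rfl

theorem coe_derivTest (t : Test) : (derivTest t : ℝ → ℂ) = deriv t := rfl

theorem D_apply_derivTest (F : Distr) (t : Test) : D F t = -F (derivTest t) :=
  D_apply F t _ fun _ => rfl

theorem integrable_mul_test {f : ℝ → ℂ} (hf : LocallyIntegrable f volume) (t : Test) :
    Integrable (fun x => f x * t x) := by
  simpa using hf.integrable_smul_right_of_hasCompactSupport t.continuous t.hasCompactSupport

theorem ofFun_congr {f g : ℝ → ℂ} (hf : LocallyIntegrable f volume)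
    (hg : LocallyIntegrable g volume) (h : f =ᵐ[volume] g) : ofFun f = ofFun g := by
  ext t
  rw [ofFun_apply f hf, ofFun_apply g hg]
  refine integral_congr_ae ?_
  filter_upwards [h] with x hx
  rw [hx]

theorem ae_of_forall_notMem {p : ℝ → Prop} (S : Finset ℝ) (h : ∀ x ∉ S, p x) :
    ∀ᵐ x : ℝ, p x := by
  have h0 : (S : Set ℝ)ᶜ ∈ ae (volume : Measure ℝ) :=
    compl_mem_ae_iff.2 (S.finite_toSet.measure_zero _)
  filter_upwards [h0] with x hx
  exact h x (by simpa using hx)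

/-- A function without jumps has no point masses in its distributional derivative. -/
theorem D_ofFun_of_no_jump {S : Finset ℝ} {h h' : ℝ → ℂ} (hreg : IsRegulated S h)
    (hreg' : LocallyIntegrable h' volume) (hd : ∀ x ∉ S, HasDerivAt h (h' x) x)
    (hj : ∀ x ∈ S, ∃ l, Tendsto h (𝓝[≠] x) (𝓝 l)) : D (ofFun h) = ofFun h' := by
  classical
  choose! l hl using hj
  -- correct the values of `h` on `S`, which makes it continuous
  set k : ℝ → ℂ := fun x => if x ∈ S then l x else h x with hk
  have hkh : ∀ x ∉ S, k x = h x := fun x hx => by simp [hk, hx]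
  have hkev : ∀ x, k =ᶠ[𝓝[≠] x] h := fun x => by
    have : ((S.erase x : Finset ℝ) : Set ℝ)ᶜ ∈ 𝓝 x :=
      (IsRegulated.isOpen_compl _).mem_nhds (by simp)
    filter_upwards [mem_nhdsWithin_of_mem_nhds this, self_mem_nhdsWithin] with y hy hyx
    exact hkh y fun hyS => hy (by simpa using ⟨hyS, hyx⟩)
  have hkev' : ∀ x ∉ S, k =ᶠ[𝓝 x] h := fun x hx => by
    filter_upwards [(IsRegulated.isOpen_compl S).mem_nhds (show x ∈ (S : Set ℝ)ᶜ by simpa using hx)]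
      with y hy
    exact hkh y (by simpa using hy)
  have hkc : Continuous k := by
    refine continuous_iff_continuousAt.2 fun x => ?_
    by_cases hx : x ∈ S
    · have : k x = l x := by simp [hk, hx]
      rw [continuousAt_iff_punctured_nhds, this]
      exact (hl x hx).congr' (hkev x).symm
    · exact (hreg.continuousAt hx).congr (hkev' x hx).symm
  have hkd : ∀ x ∉ S, HasDerivAt k (h' x) x := fun x hx =>
    (hd x hx).congr_of_eventuallyEq (hkev' x hx)
  have hki : LocallyIntegrable k volume := hkc.locallyIntegrable
  rw [ofFun_congr hreg.locallyIntegrable hki (ae_of_forall_notMem S fun x hx => (hkh x hx).symm)]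
  ext t
  rw [D_apply_derivTest, ofFun_apply _ hki, ofFun_apply _ hreg']
  have hi1 := integrable_mul_test hki (derivTest t)
  have hi2 := integrable_mul_test hreg' t
  obtain ⟨R, hR⟩ := t.hasCompactSupport.isCompact.isBounded.subset_closedBall 0
  have hR0 : ∀ x, R < |x| → t x = 0 := fun x hx => by
    refine image_eq_zero_of_notMem_tsupport fun hxt => ?_
    have := hR hxt
    simp only [mem_closedBall_zero_iff, Real.norm_eq_abs] at this
    linarith
  have hsum : ∫ x, (h' x * t x + k x * derivTest t x) = 0 := by
    set r := |R| + 1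
    have hr : R < |r| := by
      have := le_abs_self R
      have := abs_nonneg R
      rw [abs_of_pos (by positivity)]; linarith
    have h0 : ∀ x, x ∉ Ioc (-r) r → h' x * t x + k x * derivTest t x = 0 := by
      intro x hx
      have hx1 : R < |x| := by
        by_contra hcon
        push Not at hcon
        refine hx ⟨?_, ?_⟩ <;> have := abs_le.1 hcon <;> have := le_abs_self R <;> grind
      have hev : (t : ℝ → ℂ) =ᶠ[𝓝 x] fun _ => 0 := by
        filter_upwards [(isOpen_lt continuous_const continuous_abs).mem_nhds hx1] with y hy
        exact hR0 y hy
      simp [hev.deriv_eq, hR0 x hx1]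
    rw [← setIntegral_eq_integral_of_forall_compl_eq_zero h0,
      ← intervalIntegral.integral_of_le (by have := abs_nonneg R; grind)]
    rw [integral_eq_of_hasDerivAt_off_countable (fun x => k x * t x)
      (fun x => h' x * t x + k x * derivTest t x)
      S.finite_toSet.countable ((hkc.mul t.continuous).continuousOn) ?_
      ((hi2.add hi1).intervalIntegrable)]
    · simp only [hR0 r hr, hR0 (-r) (by simpa using hr)]; simp
    · rintro x ⟨-, hx⟩
      exact (hkd x (by simpa using hx)).mul
        ((contDiff_test t 1).differentiable (by simp) x).hasDerivAt
  rw [integral_add hi2 hi1] at hsum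
  exact (eq_neg_of_add_eq_zero_left hsum).symm

/-- The Heaviside function with its jump at `ξ`. -/
def heaviside (ξ : ℝ) : ℝ → ℂ := (Ioi ξ).indicator 1

theorem heaviside_eventuallyEq_left (ξ : ℝ) : heaviside ξ =ᶠ[𝓝[<] ξ] fun _ => 0 := by
  filter_upwards [self_mem_nhdsWithin] with y hy
  simp [heaviside, not_lt.2 (le_of_lt (mem_Iio.1 hy))]

theorem heaviside_eventuallyEq_right (ξ : ℝ) : heaviside ξ =ᶠ[𝓝[>] ξ] fun _ => 1 := by
  filter_upwards [self_mem_nhdsWithin] with y hy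
  simp [heaviside, mem_Ioi.1 hy]

theorem heaviside_eventuallyEq {ξ x : ℝ} (h : x ≠ ξ) :
    heaviside ξ =ᶠ[𝓝 x] fun _ => heaviside ξ x := by
  rcases h.lt_or_gt with h | h
  · filter_upwards [Iio_mem_nhds h] with y hy
    simp [heaviside, h.le, (mem_Iio.1 hy).le]
  · filter_upwards [Ioi_mem_nhds h] with y hy
    simp [heaviside, h, mem_Ioi.1 hy]

theorem isRegulated_heaviside (ξ : ℝ) : IsRegulated {ξ} (heaviside ξ) where
  continuousOn x hx := ((continuousAt_const.congr
    (heaviside_eventuallyEq (by simpa using hx)).symm)).continuousWithinAt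
  left x := by
    by_cases h : x = ξ
    · subst h
      exact ⟨0, tendsto_const_nhds.congr' (heaviside_eventuallyEq_left x).symm⟩
    · exact ⟨_, (tendsto_const_nhds.congr' (heaviside_eventuallyEq h).symm).mono_left
        nhdsWithin_le_nhds⟩
  right x := by
    by_cases h : x = ξ
    · subst h
      exact ⟨1, tendsto_const_nhds.congr' (heaviside_eventuallyEq_right x).symm⟩
    · exact ⟨_, (tendsto_const_nhds.congr' (heaviside_eventuallyEq h).symm).mono_left
        nhdsWithin_le_nhds⟩

/-- The Dirac distribution at `ξ`, as the derivative of a Heaviside function. -/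
def delta (ξ : ℝ) : Distr := D (ofFun (heaviside ξ))

@[simp] theorem delta_apply (ξ : ℝ) (t : Test) : delta ξ t = t ξ := by
  rw [delta, D_apply_derivTest, ofFun_apply _ (isRegulated_heaviside ξ).locallyIntegrable]
  have : ∀ x, heaviside ξ x * derivTest t x = (Ioi ξ).indicator (deriv t) x := fun x => by
    by_cases h : x ∈ Ioi ξ <;> simp [heaviside, h]
  simp_rw [this]
  rw [integral_indicator measurableSet_Ioi,
    HasCompactSupport.integral_Ioi_deriv_eq (contDiff_test t 1) t.hasCompactSupport, neg_neg]

theorem D_iterate_delta_apply (ξ : ℝ) (k : ℕ) (t : Test) :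
    D^[k] (delta ξ) t = (-1) ^ k * iteratedDeriv k t ξ := by
  induction k generalizing t with
  | zero => simp
  | succ k ih =>
    rw [Function.iterate_succ_apply', D_apply_derivTest, ih, coe_derivTest, iteratedDeriv_succ']
    ring

/-- The derivative of a piecewise smooth function is its pointwise derivative plus its jumps. -/
theorem D_ofFun {S : Finset ℝ} {f : ℝ → ℂ} (hf : IsSmoothOff S f) :
    D (ofFun f) = ofFun (deriv f) + ∑ ξ ∈ S, jump f ξ • delta ξ := by
  set h : ℝ → ℂ := fun x => f x - ∑ ξ ∈ S, jump f ξ * heaviside ξ x with hh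
  have hfi := hf.regulated_zero.locallyIntegrable
  have hHi : ∀ ξ, LocallyIntegrable (heaviside ξ) volume := fun ξ =>
    (isRegulated_heaviside ξ).locallyIntegrable
  have hreg : IsRegulated S h := by
    refine ⟨hf.regulated_zero.continuousOn.sub (continuousOn_finsetSum _ fun ξ hξ =>
      continuousOn_const.mul ((isRegulated_heaviside ξ).mono (by simpa using hξ)).continuousOn),
      fun x => ?_, fun x => ?_⟩
    · choose l hl using fun ξ => (isRegulated_heaviside ξ).left x
      exact ⟨_, (hf.tendsto_leftJet_zero x).sub (tendsto_finsetSum _ fun ξ _ => (hl ξ).const_mul _)⟩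
    · choose l hl using fun ξ => (isRegulated_heaviside ξ).right x
      exact ⟨_, (hf.tendsto_rightJet_zero x).sub
        (tendsto_finsetSum _ fun ξ _ => (hl ξ).const_mul _)⟩
  have h1 : ofFun h = ofFun f - ∑ ξ ∈ S, jump f ξ • ofFun (heaviside ξ) := by
    ext t
    have e : ∀ x, h x * t x = f x * t x - ∑ ξ ∈ S, jump f ξ * (heaviside ξ x * t x) := fun x => by
      simp only [hh, sub_mul, Finset.sum_mul, mul_assoc]
    rw [ofFun_apply _ hreg.locallyIntegrable]
    simp_rw [e]
    rw [integral_sub (integrable_mul_test hfi t) (integrable_finsetSum _ fun ξ _ =>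
      (integrable_mul_test (hHi ξ) t).const_mul _), integral_finsetSum _ fun ξ _ =>
      (integrable_mul_test (hHi ξ) t).const_mul _]
    simp [ofFun_apply _ hfi, ofFun_apply _ (hHi _), integral_const_mul]
  have h2 : D (ofFun h) = ofFun (deriv f) := by
    refine D_ofFun_of_no_jump hreg hf.deriv.regulated_zero.locallyIntegrable (fun x hx => ?_)
      fun x hx => ?_
    · have hc : (fun y => ∑ ξ ∈ S, jump f ξ * heaviside ξ y) =ᶠ[𝓝 x]
          fun _ => ∑ ξ ∈ S, jump f ξ * heaviside ξ x := by
        have : ∀ᶠ y in 𝓝 x, ∀ ξ ∈ S, heaviside ξ y = heaviside ξ x :=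
          (S.eventually_all).2 fun ξ hξ => heaviside_eventuallyEq (by rintro rfl; exact hx hξ)
        filter_upwards [this] with y hy
        exact Finset.sum_congr rfl fun ξ hξ => by rw [hy ξ hξ]
      simpa only [sub_zero] using
        (hf.hasDerivAt hx).fun_sub ((hasDerivAt_const x _).congr_of_eventuallyEq hc)
    · -- the other Heaviside functions are continuous at `x`, and that of `x` removes the jump
      set s : ℂ := ∑ ξ ∈ S.erase x, jump f ξ * heaviside ξ x
      have hrest : Tendsto (fun y => ∑ ξ ∈ S.erase x, jump f ξ * heaviside ξ y) (𝓝 x) (𝓝 s) :=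
        tendsto_finsetSum _ fun ξ hξ => (tendsto_const_nhds.congr' (heaviside_eventuallyEq
          (by rintro rfl; simp at hξ)).symm).const_mul _
      have e : h = fun y => f y - (jump f x * heaviside x y +
          ∑ ξ ∈ S.erase x, jump f ξ * heaviside ξ y) := by
        ext y
        rw [Finset.add_sum_erase S (fun ξ => jump f ξ * heaviside ξ y) hx]
      refine ⟨leftJet f x 0 - (jump f x * 0 + s), ?_⟩
      rw [punctured_nhds_eq_nhdsWithin_sup_nhdsWithin, e]
      refine Tendsto.sup ?_ ?_
      · exact (hf.tendsto_leftJet_zero x).sub (((tendsto_const_nhds.congr'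
          (heaviside_eventuallyEq_left x).symm).const_mul _).add
            (hrest.mono_left nhdsWithin_le_nhds))
      · have : leftJet f x 0 - (jump f x * 0 + s) = rightJet f x 0 - (jump f x * 1 + s) := by
          simp only [jump]; ring
        rw [this]
        exact (hf.tendsto_rightJet_zero x).sub (((tendsto_const_nhds.congr'
          (heaviside_eventuallyEq_right x).symm).const_mul _).add
            (hrest.mono_left nhdsWithin_le_nhds))
  have h3 := congrArg D h1
  rw [h2, D_sub, D_sum] at h3
  rw [h3]
  simp [D_smul, delta]

/-! ### Uniqueness of the Hörmander product -/

@[simp] theorem mulTest_apply (U : Opens ℝ) (g : ℝ → ℂ) (hg : ContDiffOn ℝ ∞ g U) (t : Test)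
    (ht : tsupport t ⊆ U) (x : ℝ) : mulTest U g hg t ht x = g x * t x := rfl

theorem coe_mulTest (U : Opens ℝ) (g : ℝ → ℂ) (hg : ContDiffOn ℝ ∞ g U) (t : Test)
    (ht : tsupport t ⊆ U) : (mulTest U g hg t ht : ℝ → ℂ) = fun x => g x * t x := rfl

theorem tsupport_mulTest_subset (U : Opens ℝ) (g : ℝ → ℂ) (hg : ContDiffOn ℝ ∞ g U) (t : Test)
    (ht : tsupport t ⊆ U) : tsupport (mulTest U g hg t ht) ⊆ tsupport t := by
  rw [coe_mulTest]
  exact tsupport_mul_subset_right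

theorem IsSmoothFunOn.mono {F : Distr} {g : ℝ → ℂ} {U V : Opens ℝ} (h : IsSmoothFunOn F g U)
    (hVU : (V : Set ℝ) ⊆ U) : IsSmoothFunOn F g V :=
  ⟨h.1.mono hVU, fun t ht => h.2 t (ht.trans hVU)⟩

/-- A distribution is represented by at most one smooth function on an open set. -/
theorem IsSmoothFunOn.eqOn {F : Distr} {f g : ℝ → ℂ} {U : Opens ℝ} (hf : IsSmoothFunOn F f U)
    (hg : IsSmoothFunOn F g U) : EqOn f g U := by
  have hfi : LocallyIntegrableOn f U volume :=
    hf.1.continuousOn.locallyIntegrableOn U.isOpen.measurableSet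
  have hgi : LocallyIntegrableOn g U volume :=
    hg.1.continuousOn.locallyIntegrableOn U.isOpen.measurableSet
  have key : ∀ {k : ℝ → ℂ}, ContDiffOn ℝ ∞ k U → ∀ t : Test, tsupport t ⊆ U →
      Integrable (fun x => k x * t x) := fun {k} hk t ht =>
    (mulTest U k hk t ht).continuous.integrable_of_hasCompactSupport
      (mulTest U k hk t ht).hasCompactSupport
  have h0 := U.isOpen.ae_eq_zero_of_integral_contDiff_smul_eq_zero (hfi.sub hgi)
    (fun t ht htc htU => by
      have hts : Function.support (fun x => (t x : ℂ)) = Function.support t := by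
        ext; simp
      let s : Test := ⟨fun x => (t x : ℂ), Complex.ofRealCLM.contDiff.comp ht,
        htc.comp_left (g := ((↑) : ℝ → ℂ)) (by simp), by simp⟩
      have hs : tsupport s ⊆ U := by
        change closure (Function.support (fun x => (t x : ℂ))) ⊆ U
        rw [hts]; exact htU
      have e : ∀ x, t x • (f - g) x = f x * s x - g x * s x := fun x => by
        change t x • (f x - g x) = f x * (t x : ℂ) - g x * (t x : ℂ)
        rw [Complex.real_smul]; ring
      simp_rw [e]
      rw [integral_sub (key hf.1 s hs) (key hg.1 s hs), ← hf.2 s hs, ← hg.2 s hs, sub_self])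
  refine Measure.eqOn_open_of_ae_eq (μ := volume) ?_ U.isOpen hf.1.continuousOn hg.1.continuousOn
  rw [EventuallyEq, ae_restrict_iff' U.isOpen.measurableSet]
  filter_upwards [h0] with x hx hxU
  exact sub_eq_zero.1 (hx hxU)

/-- Distributions that agree on the members of a finite open cover are equal. -/
theorem eq_of_finite_cover {ι : Type} [Fintype ι] (W : ι → Opens ℝ)
    (hW : ⋃ i, (W i : Set ℝ) = univ) {P Q : Distr}
    (h : ∀ i, ∀ t : Test, tsupport t ⊆ W i → P t = Q t) : P = Q := by
  obtain ⟨ρ, hρ⟩ := SmoothPartitionOfUnity.exists_isSubordinate (modelWithCornersSelf ℝ ℝ)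
    (s := univ) isClosed_univ (fun i => (W i : Set ℝ)) (fun i => (W i).isOpen) hW.ge
  ext t
  have hsm : ∀ i, ContDiffOn ℝ ∞ (fun x => (ρ i x : ℂ)) ((⊤ : Opens ℝ) : Set ℝ) := fun i =>
    (Complex.ofRealCLM.contDiff.comp (ρ i).contMDiff.contDiff).contDiffOn
  let s : ι → Test := fun i => mulTest ⊤ (fun x => (ρ i x : ℂ)) (hsm i) t (by simp)
  have hsum : t = ∑ i, s i := by
    ext x
    have h1 : ∑ i, ρ i x = 1 := by
      rw [← finsum_eq_sum_of_fintype]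
      exact ρ.sum_eq_one (mem_univ x)
    have h2 : (∑ i, s i) x = ∑ i, (ρ i x : ℂ) * t x := by
      simp [s]
    rw [h2, ← Finset.sum_mul, ← Complex.ofReal_sum, h1]
    simp
  rw [hsum, map_sum, map_sum]
  refine Finset.sum_congr rfl fun i _ => h i _ ?_
  refine Subset.trans ?_ (hρ i)
  rw [coe_mulTest]
  refine tsupport_mul_subset_left.trans (closure_mono fun x hx => ?_)
  simpa using hx

theorem IsDualProdOn.eq_of_isSmoothFunOn {P Q F G : Distr} {f g : ℝ → ℂ} {U V : Opens ℝ}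
    (hP : IsDualProdOn P F g U) (hg : IsSmoothFunOn G g U)
    (hQ : IsDualProdOn Q G f V) (hf : IsSmoothFunOn F f V) (t : Test)
    (ht : tsupport t ⊆ (U : Set ℝ) ∩ V) : P t = Q t := by
  obtain ⟨hg', hP⟩ := hP
  obtain ⟨hf', hQ⟩ := hQ
  have hU := ht.trans inter_subset_left
  have hV := ht.trans inter_subset_right
  rw [hP t hU, hQ t hV, hf.2 _ ((tsupport_mulTest_subset ..).trans hV),
    hg.2 _ ((tsupport_mulTest_subset ..).trans hU)]
  congr 1
  ext x
  simp only [mulTest_apply]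
  ring

theorem IsDualProdOn.eq_of_isDualProdOn {P Q F G : Distr} {g k : ℝ → ℂ} {U V : Opens ℝ}
    (hP : IsDualProdOn P F g U) (hg : IsSmoothFunOn G g U)
    (hQ : IsDualProdOn Q F k V) (hk : IsSmoothFunOn G k V) (t : Test)
    (ht : tsupport t ⊆ (U : Set ℝ) ∩ V) : P t = Q t := by
  obtain ⟨hg', hP⟩ := hP
  obtain ⟨hk', hQ⟩ := hQ
  have hU := ht.trans inter_subset_left
  have hV := ht.trans inter_subset_right
  rw [hP t hU, hQ t hV]
  congr 1
  ext x
  simp only [mulTest_apply]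
  by_cases hx : x ∈ tsupport t
  · rw [(hg.mono (V := U ⊓ V) inter_subset_left).eqOn (hk.mono (V := U ⊓ V) inter_subset_right)
      (ht hx)]
  · simp [image_eq_zero_of_notMem_tsupport hx]

theorem IsHormanderProd.unique {F G P Q : Distr} (hP : IsHormanderProd F G P)
    (hQ : IsHormanderProd F G Q) : P = Q := by
  obtain ⟨d, U, hU, hP⟩ := hP
  obtain ⟨e, V, hV, hQ⟩ := hQ
  refine eq_of_finite_cover (ι := Fin d × Fin e) (fun p => U p.1 ⊓ V p.2) ?_ ?_
  · refine eq_univ_of_forall fun x => ?_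
    obtain ⟨i, hi⟩ := mem_iUnion.1 (hU.ge (mem_univ x))
    obtain ⟨j, hj⟩ := mem_iUnion.1 (hV.ge (mem_univ x))
    exact mem_iUnion.2 ⟨(i, j), hi, hj⟩
  · rintro ⟨i, j⟩ t ht
    have ht : tsupport t ⊆ (U i : Set ℝ) ∩ V j := ht
    rcases hP i with ⟨g, hg, hPi⟩ | ⟨f, hf, hPi⟩ <;> rcases hQ j with ⟨k, hk, hQj⟩ | ⟨k, hk, hQj⟩
    · exact hPi.eq_of_isDualProdOn hg hQj hk t ht
    · exact hPi.eq_of_isSmoothFunOn hg hQj hk t ht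
    · exact hPi.eq_of_isSmoothFunOn hf hQj hk t ht
    · exact hPi.eq_of_isDualProdOn hf hQj hk t ht

theorem IsHormanderProd.hormanderProd_eq {F G P : Distr} (hP : IsHormanderProd F G P) :
    hormanderProd F G = P := by
  have h : ∃ P, IsHormanderProd F G P := ⟨P, hP⟩
  rw [hormanderProd, dif_pos h]
  exact h.choose_spec.unique hP

theorem IsStarProd.starProd_eq {F G P : Distr} (hP : IsStarProd F G P) : starProd F G = P := by
  have h : ∃ P, IsStarProd F G P := ⟨P, hP⟩
  rw [starProd, dif_pos h]
  ext t
  exact tendsto_nhds_unique (h.choose_spec t) (hP t)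

/-! ### The elements of `𝒜` -/

/-- `F` is the sum of the function `f`, piecewise smooth with singularities in `S`, and of
`∑ c ξ k • δ_ξ⁽ᵏ⁾` over `ξ ∈ S` and `k < N`; the coefficients `c ξ k` vanish outside this range. -/
structure IsRep (S : Finset ℝ) (N : ℕ) (f : ℝ → ℂ) (c : ℝ → ℕ → ℂ) (F : Distr) : Prop where
  smooth : IsSmoothOff S f
  eq : F = ofFun f + ∑ ξ ∈ S, ∑ k ∈ Finset.range N, c ξ k • D^[k] (delta ξ)
  support : ∀ ξ k, c ξ k ≠ 0 → ξ ∈ S ∧ k < N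

/-- The coefficients of the point masses of `F'`, given those of `F` and the function part `f`
of `F`. -/
def derivCoeff (S : Finset ℝ) (f : ℝ → ℂ) (c : ℝ → ℕ → ℂ) (ξ : ℝ) : ℕ → ℂ
  | 0 => open Classical in if ξ ∈ S then jump f ξ else 0
  | k + 1 => c ξ k

namespace IsRep

variable {S T : Finset ℝ} {N M : ℕ} {f g : ℝ → ℂ} {c d : ℝ → ℕ → ℂ} {F G : Distr}

theorem apply (h : IsRep S N f c F) (t : Test) :
    F t = (∫ x, f x * t x) +
      ∑ ξ ∈ S, ∑ k ∈ Finset.range N, c ξ k * ((-1) ^ k * iteratedDeriv k t ξ) := by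
  rw [h.eq]
  simp [ofFun_apply _ h.smooth.regulated_zero.locallyIntegrable, D_iterate_delta_apply]

theorem deriv (h : IsRep S N f c F) :
    IsRep S (N + 1) (deriv f) (derivCoeff S f c) (D F) where
  smooth := h.smooth.deriv
  eq := by
    rw [h.eq, D_add, D_ofFun h.smooth, D_sum, add_assoc, ← Finset.sum_add_distrib]
    congr 1
    refine Finset.sum_congr rfl fun ξ hξ => ?_
    rw [Finset.sum_range_succ', D_sum, add_comm]
    congr 1
    · refine Finset.sum_congr rfl fun k _ => ?_
      rw [D_smul, ← Function.iterate_succ_apply' D k, derivCoeff]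
    · simp [derivCoeff, hξ]
  support ξ k hk := by
    cases k with
    | zero =>
      simp only [derivCoeff, ne_eq, ite_eq_right_iff, Classical.not_imp] at hk
      exact ⟨hk.1, by simp⟩
    | succ k =>
      have := h.support ξ k hk
      exact ⟨this.1, by lia⟩

theorem ofFun (hf : IsSmoothOff S f) : IsRep S 0 f 0 (ofFun f) where
  smooth := hf
  eq := by simp
  support := by simp

theorem isSmoothFunOn (h : IsRep S N f c F) :
    IsSmoothFunOn F f ⟨(S : Set ℝ)ᶜ, IsRegulated.isOpen_compl S⟩ := by
  refine ⟨h.smooth.contDiffOn, fun t ht => ?_⟩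
  rw [h.apply, add_eq_left]
  refine Finset.sum_eq_zero fun ξ hξ => Finset.sum_eq_zero fun k _ => ?_
  have h0 : (t : ℝ → ℂ) =ᶠ[𝓝 ξ] fun _ => 0 := notMem_tsupport_iff_eventuallyEq.1 fun hx => ht hx hξ
  simp [h0.iteratedDeriv_eq]

end IsRep

theorem exists_isRep {F : Distr} (hF : F ∈ A) :
    ∃ (S : Finset ℝ) (N : ℕ) (f : ℝ → ℂ) (c : ℝ → ℕ → ℂ), IsRep S N f c F := by
  obtain ⟨G, ⟨g, hg, rfl⟩, n, rfl⟩ := hF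
  obtain ⟨S, hS⟩ := hg.exists_isSmoothOff
  induction n with
  | zero => exact ⟨S, 0, g, 0, IsRep.ofFun hS⟩
  | succ n ih =>
    obtain ⟨S, N, f, c, h⟩ := ih
    rw [Function.iterate_succ_apply']
    exact ⟨_, _, _, _, h.deriv⟩

/-! ### The product `F * G` of elements of `𝒜` -/

/-- The product of `δ_ξ⁽ᵏ⁾` by a smooth function whose derivatives at `ξ` are `γ 0, γ 1, …`. -/
def deltaProd (γ : ℕ → ℂ) (ξ : ℝ) (k : ℕ) : Distr :=
  ∑ j ∈ Finset.range (k + 1), ((-1) ^ j * (k.choose j : ℂ) * γ j) • D^[k - j] (delta ξ)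

theorem deltaProd_apply (γ : ℕ → ℂ) (ξ : ℝ) (k : ℕ) (t : Test) :
    deltaProd γ ξ k t = (-1) ^ k *
      ∑ j ∈ Finset.range (k + 1), (k.choose j : ℂ) * γ j * iteratedDeriv (k - j) t ξ := by
  simp only [deltaProd, _root_.sum_apply, _root_.smul_apply,
    D_iterate_delta_apply, Finset.mul_sum, smul_eq_mul]
  refine Finset.sum_congr rfl fun j hj => ?_
  have hj : j ≤ k := by simpa [Nat.lt_succ_iff] using hj
  obtain ⟨i, rfl⟩ := Nat.exists_eq_add_of_le hj
  simp only [add_tsub_cancel_left, pow_add]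
  ring

theorem deltaProd_iteratedDeriv {g : ℝ → ℂ} {ξ : ℝ} {k : ℕ} (hg : ContDiffAt ℝ k g ξ) (t : Test) :
    deltaProd (fun j => iteratedDeriv j g ξ) ξ k t
      = (-1) ^ k * iteratedDeriv k (fun x => g x * t x) ξ := by
  rw [deltaProd_apply, iteratedDeriv_fun_mul hg (contDiff_test t k).contDiffAt]

theorem tendsto_deltaProd {ι : Type*} {l : Filter ι} {γ : ι → ℕ → ℂ} {γ' : ℕ → ℂ} {ξ : ι → ℝ}
    {ξ' : ℝ} (hγ : ∀ j, Tendsto (fun i => γ i j) l (𝓝 (γ' j))) (hξ : Tendsto ξ l (𝓝 ξ')) (k : ℕ)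
    (t : Test) : Tendsto (fun i => deltaProd (γ i) (ξ i) k t) l (𝓝 (deltaProd γ' ξ' k t)) := by
  simp only [deltaProd_apply]
  refine (tendsto_finsetSum _ fun j _ => ((hγ j).const_mul _).mul ?_).const_mul _
  exact ((contDiff_test t (k - j)).continuous_iteratedDeriv' _).tendsto ξ' |>.comp hξ

theorem translateTest_apply (ε : ℝ) (t : Test) (x : ℝ) : translateTest ε t x = t (x - ε) := rfl

theorem coe_translateTest (ε : ℝ) (t : Test) :
    (translateTest ε t : ℝ → ℂ) = fun x => t (x - ε) := rfl

theorem translate_apply (ε : ℝ) (G : Distr) (t : Test) :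
    translate ε G t = G (translateTest ε t) := rfl

variable {S T : Finset ℝ} {N M : ℕ} {f g : ℝ → ℂ} {c d : ℝ → ℕ → ℂ} {F G : Distr}

theorem IsRep.translate_apply (h : IsRep T M g d G) (ε : ℝ) (t : Test) :
    translate ε G t = (∫ x, g (x + ε) * t x) +
      ∑ η ∈ T, ∑ k ∈ Finset.range M, d η k * ((-1) ^ k * iteratedDeriv k t (η - ε)) := by
  rw [BeamODE.translate_apply, h.apply]
  congr 1
  · rw [← integral_add_right_eq_self _ ε]
    simp [translateTest_apply]
  · simp [coe_translateTest, iteratedDeriv_comp_sub_const]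

theorem isOpen_add_notMem (T : Finset ℝ) (ε : ℝ) : IsOpen {x : ℝ | x + ε ∉ T} :=
  (IsRegulated.isOpen_compl T).preimage (continuous_id.add continuous_const)

theorem IsRep.isSmoothFunOn_translate (h : IsRep T M g d G) (ε : ℝ) :
    IsSmoothFunOn (translate ε G) (fun x => g (x + ε))
      ⟨{x | x + ε ∉ T}, isOpen_add_notMem T ε⟩ := by
  refine ⟨h.smooth.contDiffOn.comp (by fun_prop) fun x hx => by simpa using hx, fun t ht => ?_⟩
  rw [h.translate_apply, add_eq_left]
  refine Finset.sum_eq_zero fun ξ hξ => Finset.sum_eq_zero fun k _ => ?_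
  have h0 : (t : ℝ → ℂ) =ᶠ[𝓝 (ξ - ε)] fun _ => 0 :=
    notMem_tsupport_iff_eventuallyEq.1 fun hx => ht hx (by simpa using hξ)
  simp [h0.iteratedDeriv_eq]

/-- The product `F(x) · G(x + ε)` when the singularities of the factors are disjoint. -/
def shiftedProd (S : Finset ℝ) (N : ℕ) (f : ℝ → ℂ) (c : ℝ → ℕ → ℂ) (T : Finset ℝ) (M : ℕ)
    (g : ℝ → ℂ) (d : ℝ → ℕ → ℂ) (ε : ℝ) : Distr :=
  ofFun (fun x => f x * g (x + ε)) +
    ∑ ξ ∈ S, ∑ k ∈ Finset.range N, c ξ k • deltaProd (fun j => iteratedDeriv j g (ξ + ε)) ξ k +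
    ∑ η ∈ T, ∑ k ∈ Finset.range M,
      d η k • deltaProd (fun j => iteratedDeriv j f (η - ε)) (η - ε) k

/-- The limit of `F(x) · G(x + ε)` as `ε ↓ 0`: point masses of `F` see the right-hand jet of `G`,
point masses of `G` see the left-hand jet of `F`. -/
def limitProd (S : Finset ℝ) (N : ℕ) (f : ℝ → ℂ) (c : ℝ → ℕ → ℂ) (T : Finset ℝ) (M : ℕ)
    (g : ℝ → ℂ) (d : ℝ → ℕ → ℂ) : Distr :=
  ofFun (fun x => f x * g x) +
    ∑ ξ ∈ S, ∑ k ∈ Finset.range N, c ξ k • deltaProd (rightJet g ξ) ξ k +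
    ∑ η ∈ T, ∑ k ∈ Finset.range M, d η k • deltaProd (leftJet f η) η k

theorem deltaProd_eq_zero {γ : ℕ → ℂ} {ξ : ℝ} {k : ℕ} {t : Test} (h : ξ ∉ tsupport t) :
    deltaProd γ ξ k t = 0 := by
  have h0 : (t : ℝ → ℂ) =ᶠ[𝓝 ξ] fun _ => 0 := notMem_tsupport_iff_eventuallyEq.1 h
  simp [deltaProd_apply, h0.iteratedDeriv_eq]

theorem isHormanderProd_shiftedProd (hF : IsRep S N f c F) (hG : IsRep T M g d G) {ε : ℝ}
    (hε : ∀ ξ ∈ S, ξ + ε ∉ T) :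
    IsHormanderProd F (translate ε G) (shiftedProd S N f c T M g d ε) := by
  classical
  set U : Opens ℝ := ⟨{x | x + ε ∉ T}, isOpen_add_notMem T ε⟩
  set V : Opens ℝ := ⟨(S : Set ℝ)ᶜ, IsRegulated.isOpen_compl S⟩
  have hint : LocallyIntegrable (fun x => f x * g (x + ε)) volume :=
    (hF.smooth.regulated_zero.mul
      (hG.smooth.regulated_zero.comp_add_const ε)).locallyIntegrable
  have happ : ∀ t : Test, shiftedProd S N f c T M g d ε t = (∫ x, f x * g (x + ε) * t x) +
      (∑ ξ ∈ S, ∑ k ∈ Finset.range N,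
        c ξ k * deltaProd (fun j => iteratedDeriv j g (ξ + ε)) ξ k t) +
      ∑ η ∈ T, ∑ k ∈ Finset.range M,
        d η k * deltaProd (fun j => iteratedDeriv j f (η - ε)) (η - ε) k t := fun t => by
    simp [shiftedProd, ofFun_apply _ hint]
  have hGs : IsSmoothFunOn (translate ε G) (fun x => g (x + ε)) U := hG.isSmoothFunOn_translate ε
  have hFs : IsSmoothFunOn F f V := hF.isSmoothFunOn
  have hGU : ContDiffOn ℝ ∞ (fun x => g (x + ε)) U := hGs.1
  have hFV : ContDiffOn ℝ ∞ f V := hFs.1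
  have hU : IsDualProdOn (shiftedProd S N f c T M g d ε) F (fun x => g (x + ε)) U := by
    refine ⟨hGU, fun t ht => ?_⟩
    rw [happ, hF.apply]
    have h0 : ∑ η ∈ T, ∑ k ∈ Finset.range M,
        d η k * deltaProd (fun j => iteratedDeriv j f (η - ε)) (η - ε) k t = 0 :=
      Finset.sum_eq_zero fun η hη => Finset.sum_eq_zero fun k _ => by
        rw [deltaProd_eq_zero, mul_zero]
        exact fun hx => ht hx (by simpa using hη)
    rw [h0, add_zero]
    congr 1
    · simp [mul_assoc]
    · refine Finset.sum_congr rfl fun ξ hξ => Finset.sum_congr rfl fun k _ => ?_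
      rw [coe_mulTest, ← deltaProd_iteratedDeriv
        (contDiffAt_of_contDiffOn_isOpen U.isOpen hGU (hε ξ hξ) k)]
      simp [iteratedDeriv_comp_add_const]
  have hV : IsDualProdOn (shiftedProd S N f c T M g d ε) (translate ε G) f V := by
    refine ⟨hFV, fun t ht => ?_⟩
    rw [happ, hG.translate_apply]
    have h0 : ∑ ξ ∈ S, ∑ k ∈ Finset.range N,
        c ξ k * deltaProd (fun j => iteratedDeriv j g (ξ + ε)) ξ k t = 0 :=
      Finset.sum_eq_zero fun ξ hξ => Finset.sum_eq_zero fun k _ => by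
        rw [deltaProd_eq_zero, mul_zero]
        exact fun hx => ht hx hξ
    rw [h0, add_zero]
    congr 1
    · congr 1
      ext x
      rw [mulTest_apply]
      ring
    · refine Finset.sum_congr rfl fun η hη => Finset.sum_congr rfl fun k _ => ?_
      rw [coe_mulTest, ← deltaProd_iteratedDeriv]
      refine contDiffAt_of_contDiffOn_isOpen V.isOpen hFV (fun hx => ?_) k
      exact hε _ hx (by simpa using hη)
  refine ⟨2, ![U, V], eq_univ_of_forall fun x => mem_iUnion.2 ?_, ?_⟩
  · by_cases hx : x ∈ S
    · exact ⟨0, hε x hx⟩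
    · exact ⟨1, by simpa [V] using hx⟩
  · rw [Fin.forall_fin_two]
    exact ⟨Or.inl ⟨_, hGs, hU⟩, Or.inr ⟨_, hFs, hV⟩⟩

theorem tendsto_integral_mul_shift (hf : IsRegulated S f) (hg : IsRegulated T g) (t : Test) :
    Tendsto (fun ε => ∫ x, f x * g (x + ε) * t x) (𝓝[>] 0) (𝓝 (∫ x, f x * g x * t x)) := by
  have hft := integrable_mul_test hf.locallyIntegrable t
  have hK : IsCompact ((fun p : ℝ × ℝ => p.1 + p.2) '' (tsupport t ×ˢ Icc 0 1)) :=
    (t.hasCompactSupport.isCompact.prod isCompact_Icc).image (by fun_prop)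
  obtain ⟨C, hC⟩ := hg.exists_bound hK
  refine tendsto_integral_filter_of_dominated_convergence (fun x => C * ‖f x * t x‖) ?_ ?_
    (hft.norm.const_mul C) ?_
  · refine Eventually.of_forall fun ε => ?_
    exact (hf.aestronglyMeasurable.mul (hg.comp_add_const ε).aestronglyMeasurable).mul
      t.continuous.aestronglyMeasurable
  · filter_upwards [Ioc_mem_nhdsGT (zero_lt_one (α := ℝ))] with ε hε
    refine ae_of_all _ fun x => ?_
    by_cases hx : x ∈ tsupport t
    · have := hC (x + ε) ⟨(x, ε), ⟨hx, hε.1.le, hε.2⟩, rfl⟩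
      calc ‖f x * g (x + ε) * t x‖ = ‖g (x + ε)‖ * ‖f x * t x‖ := by
            simp only [norm_mul]; ring
        _ ≤ C * ‖f x * t x‖ := by gcongr
    · simp [image_eq_zero_of_notMem_tsupport hx]
  · refine ae_of_forall_notMem T fun x hx => ?_
    have h1 : Tendsto (fun ε : ℝ => x + ε) (𝓝[>] 0) (𝓝 x) := by
      have : Tendsto (fun ε : ℝ => x + ε) (𝓝 0) (𝓝 (x + 0)) :=
        (continuous_const.add continuous_id).tendsto 0
      rw [add_zero] at this
      exact this.mono_left nhdsWithin_le_nhds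
    exact (((hg.continuousAt hx).tendsto.comp h1).const_mul (f x)).mul_const (t x)

theorem tendsto_const_add_nhdsGT (x : ℝ) : Tendsto (fun ε => x + ε) (𝓝[>] 0) (𝓝[>] x) := by
  simpa [add_comm] using IsRegulated.tendsto_add_const_nhdsGT 0 x

theorem tendsto_const_sub_nhdsLT (x : ℝ) : Tendsto (fun ε => x - ε) (𝓝[>] 0) (𝓝[<] x) := by
  refine tendsto_nhdsWithin_iff.2 ⟨?_, ?_⟩
  · have : Tendsto (fun ε : ℝ => x - ε) (𝓝 0) (𝓝 (x - 0)) :=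
      (continuous_const.sub continuous_id).tendsto 0
    rw [sub_zero] at this
    exact this.mono_left nhdsWithin_le_nhds
  · filter_upwards [self_mem_nhdsWithin] with ε hε
    exact sub_lt_self x hε

theorem eventually_disjoint_shift (S T : Finset ℝ) :
    ∀ᶠ ε in 𝓝[>] (0 : ℝ), ∀ ξ ∈ S, ξ + ε ∉ T := by
  refine (S.eventually_all).2 fun ξ _ => ?_
  have h0 : ((T.erase ξ : Finset ℝ) : Set ℝ)ᶜ ∈ 𝓝 ξ :=
    (IsRegulated.isOpen_compl _).mem_nhds (by simp)
  have h1 := (tendsto_const_add_nhdsGT ξ).eventually (mem_nhdsWithin_of_mem_nhds h0)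
  filter_upwards [h1, self_mem_nhdsWithin] with ε hε hpos hT
  exact hε (by simpa [(mem_Ioi.1 hpos).ne'] using hT)

theorem isStarProd_limitProd (hF : IsRep S N f c F) (hG : IsRep T M g d G) :
    IsStarProd F G (limitProd S N f c T M g d) := by
  classical
  intro t
  have h1 : (fun ε => shiftedProd S N f c T M g d ε t)
      =ᶠ[𝓝[>] 0] fun ε => hormanderProd F (translate ε G) t := by
    filter_upwards [eventually_disjoint_shift S T] with ε hε
    rw [(isHormanderProd_shiftedProd hF hG hε).hormanderProd_eq]
  refine Tendsto.congr' h1 ?_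
  have hint : ∀ ε, LocallyIntegrable (fun x => f x * g (x + ε)) volume := fun ε =>
    (hF.smooth.regulated_zero.mul
      (hG.smooth.regulated_zero.comp_add_const ε)).locallyIntegrable
  have hint' : LocallyIntegrable (fun x => f x * g x) volume :=
    (hF.smooth.regulated_zero.mul hG.smooth.regulated_zero).locallyIntegrable
  simp only [shiftedProd, limitProd, _root_.add_apply, ofFun_apply _ (hint _),
    ofFun_apply _ hint', _root_.sum_apply, _root_.smul_apply]
  refine ((tendsto_integral_mul_shift hF.smooth.regulated_zero hG.smooth.regulated_zero t).add
    ?_).add ?_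
  · refine tendsto_finsetSum _ fun ξ _ => tendsto_finsetSum _ fun k _ =>
      (tendsto_deltaProd (fun j => ?_) tendsto_const_nhds k t).const_smul _
    exact (hG.smooth.tendsto_rightJet ξ j).comp (tendsto_const_add_nhdsGT ξ)
  · refine tendsto_finsetSum _ fun η _ => tendsto_finsetSum _ fun k _ =>
      (tendsto_deltaProd (fun j => ?_) ?_ k t).const_smul _
    · exact (hF.smooth.tendsto_leftJet η j).comp (tendsto_const_sub_nhdsLT η)
    · exact (tendsto_const_sub_nhdsLT η).mono_right nhdsWithin_le_nhds

/-! ### Leading coefficients by rescaling -/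

/-- The rescaled test function `x ↦ t ((m + 1) (x - ξ))`. -/
def zoom (ξ : ℝ) (m : ℕ) (t : Test) : Test where
  toFun x := t (((m : ℝ) + 1) * (x - ξ))
  contDiff' := t.contDiff.comp (contDiff_const.mul (contDiff_id.sub contDiff_const))
  hasCompactSupport' := t.hasCompactSupport.comp_homeomorph
    ((Homeomorph.subRight ξ).trans (Homeomorph.mulLeft₀ ((m : ℝ) + 1) (by positivity)))
  tsupport_subset' := by simp

theorem zoom_apply (ξ : ℝ) (m : ℕ) (t : Test) (x : ℝ) :
    zoom ξ m t x = t (((m : ℝ) + 1) * (x - ξ)) := rfl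

theorem iteratedDeriv_zoom (ξ : ℝ) (m : ℕ) (t : Test) (k : ℕ) (x : ℝ) :
    iteratedDeriv k (zoom ξ m t) x
      = ((m : ℂ) + 1) ^ k * iteratedDeriv k t (((m : ℝ) + 1) * (x - ξ)) := by
  have h : (zoom ξ m t : ℝ → ℂ) = fun x => (fun y => t (((m : ℝ) + 1) * y)) (x - ξ) := rfl
  rw [h, iteratedDeriv_comp_sub_const k (fun y => t (((m : ℝ) + 1) * y)) ξ,
    iteratedDeriv_comp_const_smul (contDiff_test t k)]
  simp

theorem derivTest_zoom (ξ : ℝ) (m : ℕ) (t : Test) :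
    derivTest (zoom ξ m t) = ((m : ℂ) + 1) • zoom ξ m (derivTest t) := by
  ext x
  have := iteratedDeriv_zoom ξ m t 1 x
  simp only [iteratedDeriv_one, pow_one] at this
  simp [this, zoom_apply]

theorem eventually_zoom_notMem_tsupport {ξ x : ℝ} (hx : x ≠ ξ) (t : Test) :
    ∀ᶠ m : ℕ in atTop, ((m : ℝ) + 1) * (x - ξ) ∉ tsupport t := by
  have h1 : Tendsto (fun m : ℕ => ((m : ℝ) + 1) * |x - ξ|) atTop atTop :=
    (tendsto_atTop_add_const_right _ _ tendsto_natCast_atTop_atTop).atTop_mul_const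
      (abs_pos.2 (sub_ne_zero.2 hx))
  obtain ⟨R, hR⟩ := t.hasCompactSupport.isCompact.isBounded.subset_closedBall 0
  filter_upwards [h1.eventually_gt_atTop R] with m hm hmt
  have := hR hmt
  rw [mem_closedBall_zero_iff, Real.norm_eq_abs, abs_mul, abs_of_nonneg (by positivity)] at this
  linarith

/-- `v` is the coefficient of `δ_ξ⁽ᴷ⁾` in `F`, and `F` has no point mass of higher order at `ξ`.
This is expressed by the behaviour of `F` on test functions that shrink to `ξ`: applied to
`t (λ (x - ξ))`, `δ_ξ⁽ᵏ⁾` grows like `λᵏ`. -/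
def HasCoeff (F : Distr) (ξ : ℝ) (K : ℕ) (v : ℂ) : Prop :=
  ∀ t : Test, Tendsto (fun m : ℕ => (((m : ℂ) + 1) ^ K)⁻¹ * F (zoom ξ m t)) atTop
    (𝓝 (v * ((-1) ^ K * iteratedDeriv K t 0)))

theorem tendsto_inv_natCast_add_one : Tendsto (fun m : ℕ => ((m : ℂ) + 1)⁻¹) atTop (𝓝 0) := by
  simpa using tendsto_one_div_add_atTop_nhds_zero_nat (𝕜 := ℂ)

/-- There are test functions with nonzero `K`-th derivative at `0`. -/
theorem exists_test_iteratedDeriv_ne_zero (K : ℕ) : ∃ t : Test, iteratedDeriv K t 0 ≠ 0 := by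
  let b : ContDiffBump (0 : ℝ) := ⟨1, 2, one_pos, one_lt_two⟩
  have he : ContDiff ℝ ∞ fun x : ℝ => Complex.exp x :=
    Complex.contDiff_exp.comp Complex.ofRealCLM.contDiff
  have hb : ContDiff ℝ ∞ fun x : ℝ => (b x : ℂ) := Complex.ofRealCLM.contDiff.comp b.contDiff
  have hbc : HasCompactSupport fun x : ℝ => (b x : ℂ) :=
    b.hasCompactSupport.comp_left (g := ((↑) : ℝ → ℂ)) (by simp)
  let t : Test := ⟨fun x => Complex.exp x * b x, he.mul hb, hbc.mul_left, by simp⟩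
  have h1 : (t : ℝ → ℂ) =ᶠ[𝓝 0] fun x : ℝ => Complex.exp x := by
    filter_upwards [b.eventuallyEq_one] with x hx
    change Complex.exp x * b x = _
    simp [hx]
  have h2 : ∀ k : ℕ, iteratedDeriv k (fun x : ℝ => Complex.exp x) = fun x : ℝ => Complex.exp x := by
    intro k
    induction k with
    | zero => simp
    | succ k ih =>
      rw [iteratedDeriv_succ, ih]
      ext x
      exact (Complex.hasDerivAt_exp x).comp_ofReal.deriv
  exact ⟨t, by simp [h1.iteratedDeriv_eq, h2]⟩

namespace HasCoeff

variable {F G : Distr} {ξ : ℝ} {K : ℕ} {v v' : ℂ}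

theorem unique (h : HasCoeff F ξ K v) (h' : HasCoeff F ξ K v') : v = v' := by
  obtain ⟨t, ht⟩ := exists_test_iteratedDeriv_ne_zero K
  have h0 : ((-1) ^ K * iteratedDeriv K t 0 : ℂ) ≠ 0 :=
    mul_ne_zero (pow_ne_zero _ (by simp)) ht
  exact mul_right_cancel₀ h0 (tendsto_nhds_unique (h t) (h' t))

theorem add (h : HasCoeff F ξ K v) (h' : HasCoeff G ξ K v') : HasCoeff (F + G) ξ K (v + v') :=
  fun t => by simpa [mul_add, add_mul] using (h t).add (h' t)

theorem smul (a : ℂ) (h : HasCoeff F ξ K v) : HasCoeff (a • F) ξ K (a * v) :=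
  fun t => by simpa [mul_left_comm, mul_assoc] using (h t).const_mul a

theorem sub (h : HasCoeff F ξ K v) (h' : HasCoeff G ξ K v') : HasCoeff (F - G) ξ K (v - v') :=
  fun t => by simpa [mul_sub, sub_mul] using (h t).sub (h' t)

theorem zero : HasCoeff 0 ξ K 0 := fun t => by simp

theorem sum {ι : Type*} (s : Finset ι) {F : ι → Distr} {v : ι → ℂ}
    (h : ∀ i ∈ s, HasCoeff (F i) ξ K (v i)) : HasCoeff (∑ i ∈ s, F i) ξ K (∑ i ∈ s, v i) := by
  induction s using Finset.cons_induction with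
  | empty => simpa using zero
  | cons a s ha ih =>
    rw [Finset.sum_cons, Finset.sum_cons]
    exact (h a (by simp)).add (ih fun i hi => h i (by simp [hi]))

theorem D (h : HasCoeff F ξ K v) : HasCoeff (D F) ξ (K + 1) v := fun t => by
  have h1 := (h (derivTest t)).neg
  have e : ∀ m : ℕ, (((m : ℂ) + 1) ^ (K + 1))⁻¹ * BeamODE.D F (zoom ξ m t)
      = -((((m : ℂ) + 1) ^ K)⁻¹ * F (zoom ξ m (derivTest t))) := fun m => by
    have : (m : ℂ) + 1 ≠ 0 := by exact_mod_cast m.succ_ne_zero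
    rw [D_apply_derivTest, derivTest_zoom, map_smul, smul_eq_mul]
    field_simp
    ring
  simp_rw [e]
  convert h1 using 2
  rw [coe_derivTest, ← iteratedDeriv_succ']
  ring

theorem succ (h : HasCoeff F ξ K v) : HasCoeff F ξ (K + 1) 0 := fun t => by
  have h1 := (h t).mul tendsto_inv_natCast_add_one
  rw [mul_zero] at h1
  rw [zero_mul]
  refine h1.congr fun m => ?_
  rw [pow_succ, mul_inv]
  ring

theorem of_lt (h : HasCoeff F ξ K v) {L : ℕ} (hL : K < L) : HasCoeff F ξ L 0 := by
  induction L, hL using Nat.le_induction with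
  | base => exact h.succ
  | succ L _ ih => exact ih.succ

theorem D_iterate (h : HasCoeff F ξ K v) (n : ℕ) : HasCoeff (BeamODE.D^[n] F) ξ (K + n) v := by
  induction n with
  | zero => exact h
  | succ n ih =>
    rw [Function.iterate_succ_apply']
    exact ih.D

end HasCoeff

theorem IsRegular.hasCoeff {R : Distr} (hR : IsRegular R) (ξ : ℝ) : HasCoeff R ξ 0 0 := by
  obtain ⟨r, hr, rfl⟩ := hR
  intro t
  simp only [pow_zero, inv_one, one_mul, zero_mul, ofFun_apply r hr, zoom_apply]
  obtain ⟨C, hC⟩ := t.continuous.bounded_above_of_compact_support t.hasCompactSupport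
  obtain ⟨Q, hQ⟩ := t.hasCompactSupport.isCompact.isBounded.subset_closedBall 0
  set B := Metric.closedBall ξ Q
  have hB : IntegrableOn r B := hr.integrableOn_isCompact (isCompact_closedBall ξ Q)
  have hsupp : ∀ (m : ℕ) x, x ∉ B → t (((m : ℝ) + 1) * (x - ξ)) = 0 := fun m x hx => by
    refine image_eq_zero_of_notMem_tsupport fun hmem => hx ?_
    have := hQ hmem
    rw [mem_closedBall_zero_iff, Real.norm_eq_abs, abs_mul, abs_of_nonneg (by positivity)] at this
    rw [Metric.mem_closedBall, Real.dist_eq]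
    nlinarith [abs_nonneg (x - ξ), (Nat.cast_nonneg m : (0 : ℝ) ≤ m)]
  have hlim := tendsto_integral_of_dominated_convergence (μ := volume)
    (F := fun (m : ℕ) x => r x * t (((m : ℝ) + 1) * (x - ξ))) (f := fun _ => 0)
    (fun x => B.indicator (fun x => C * ‖r x‖) x) ?_ ?_ ?_ ?_
  · simpa using hlim
  · exact fun m => hr.aestronglyMeasurable.mul (zoom ξ m t).continuous.aestronglyMeasurable
  · exact (integrable_indicator_iff Metric.isClosed_closedBall.measurableSet).2
      (hB.norm.const_mul C)
  · refine fun m => ae_of_all _ fun x => ?_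
    by_cases hx : x ∈ B
    · rw [indicator_of_mem hx, norm_mul, mul_comm]
      gcongr
      exact hC _
    · simp [hsupp m x hx, hx]
  · refine ae_of_forall_notMem {ξ} fun x hx => tendsto_const_nhds.congr' ?_
    filter_upwards [eventually_zoom_notMem_tsupport (by simpa using hx) t] with m hm
    simp [image_eq_zero_of_notMem_tsupport hm]

theorem hasCoeff_D_iterate_delta_of_ne {η ξ : ℝ} (h : η ≠ ξ) (k K : ℕ) :
    HasCoeff (D^[k] (delta η)) ξ K 0 := fun t => by
  rw [zero_mul]
  refine tendsto_const_nhds.congr' ?_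
  filter_upwards [eventually_zoom_notMem_tsupport h t] with m hm
  have h0 : (t : ℝ → ℂ) =ᶠ[𝓝 (((m : ℝ) + 1) * (η - ξ))] fun _ => 0 :=
    notMem_tsupport_iff_eventuallyEq.1 hm
  simp [D_iterate_delta_apply, iteratedDeriv_zoom, h0.iteratedDeriv_eq]

theorem hasCoeff_D_iterate_delta (ξ : ℝ) (k : ℕ) : HasCoeff (D^[k] (delta ξ)) ξ k 1 := by
  have h : HasCoeff (delta ξ) ξ 0 1 := fun t => by simp [zoom_apply]
  simpa using h.D_iterate k

theorem hasCoeff_deltaProd_of_ne (γ : ℕ → ℂ) {η ξ : ℝ} (h : η ≠ ξ) (k K : ℕ) :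
    HasCoeff (deltaProd γ η k) ξ K 0 := by
  have := HasCoeff.sum (Finset.range (k + 1)) fun j _ =>
    (hasCoeff_D_iterate_delta_of_ne h (k - j) K).smul ((-1) ^ j * (k.choose j : ℂ) * γ j)
  simpa [deltaProd] using this

theorem hasCoeff_deltaProd (γ : ℕ → ℂ) (ξ : ℝ) (k : ℕ) :
    HasCoeff (deltaProd γ ξ k) ξ k (γ 0) := by
  have := (HasCoeff.sum (Finset.range k) fun j hj =>
    ((hasCoeff_D_iterate_delta ξ (k - (j + 1))).of_lt (L := k)
      (by have := Finset.mem_range.1 hj; lia)).smul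
        ((-1) ^ (j + 1) * (k.choose (j + 1) : ℂ) * γ (j + 1))).add
      ((hasCoeff_D_iterate_delta ξ k).smul ((-1) ^ 0 * (k.choose 0 : ℂ) * γ 0))
  rw [deltaProd, Finset.sum_range_succ']
  simpa using this

theorem zero_smul_distr (F : Distr) : (0 : ℂ) • F = 0 := by
  ext t
  simp

/-- The leading coefficient at `ξ` of a combination of point masses. -/
theorem hasCoeff_sum_pointMass {S : Finset ℝ} {N : ℕ} {c : ℝ → ℕ → ℂ} {ξ : ℝ} {K : ℕ}
    {E : ℝ → ℕ → Distr} {v : ℂ} (hc : ∀ ξ k, c ξ k ≠ 0 → ξ ∈ S ∧ k < N)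
    (hK : ∀ j, K < j → c ξ j = 0) (hne : ∀ η, η ≠ ξ → ∀ k, HasCoeff (E η k) ξ K 0)
    (hlt : ∀ k, k < K → HasCoeff (E ξ k) ξ K 0) (heq : HasCoeff (E ξ K) ξ K v) :
    HasCoeff (∑ η ∈ S, ∑ k ∈ Finset.range N, c η k • E η k) ξ K (c ξ K * v) := by
  classical
  have h1 : ∀ η k, HasCoeff (c η k • E η k) ξ K (if η = ξ ∧ k = K then c ξ K * v else 0) := by
    intro η k
    by_cases hη : η = ξ
    · subst hη
      rcases lt_trichotomy k K with hk | rfl | hk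
      · have := (hlt k hk).smul (c η k)
        rwa [if_neg (fun h : η = η ∧ k = K => hk.ne h.2), ← mul_zero (c η k)]
      · have := heq.smul (c η k)
        rwa [if_pos ⟨rfl, rfl⟩]
      · have := HasCoeff.zero (ξ := η) (K := K)
        rwa [if_neg (fun h : η = η ∧ k = K => hk.ne' h.2), hK k hk, zero_smul_distr]
    · have := (hne η hη k).smul (c η k)
      rwa [if_neg (fun h : η = ξ ∧ k = K => hη h.1), ← mul_zero (c η k)]
  have h := HasCoeff.sum S fun η _ => HasCoeff.sum (Finset.range N) fun k _ => h1 η k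
  convert h using 1
  by_cases h0 : c ξ K = 0
  · simp [h0]
  · obtain ⟨hξ, hKN⟩ := hc ξ K h0
    rw [Finset.sum_eq_single_of_mem ξ hξ (fun η _ hη => by simp [hη]),
      Finset.sum_eq_single_of_mem K (Finset.mem_range.2 hKN) (fun k _ hk => by simp [hk])]
    simp

theorem IsSmoothOff.isRegular {S : Finset ℝ} {f : ℝ → ℂ} (hf : IsSmoothOff S f) :
    IsRegular (ofFun f) :=
  ⟨f, hf.regulated_zero.locallyIntegrable, rfl⟩

theorem IsRegular.hasCoeff_zero {R : Distr} (hR : IsRegular R) (ξ : ℝ) (K : ℕ) :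
    HasCoeff R ξ K 0 := by
  rcases K.eq_zero_or_pos with rfl | hK
  · exact hR.hasCoeff ξ
  · exact (hR.hasCoeff ξ).of_lt hK

theorem IsRep.hasCoeff {S : Finset ℝ} {N : ℕ} {f : ℝ → ℂ} {c : ℝ → ℕ → ℂ} {F : Distr}
    (h : IsRep S N f c F) {ξ : ℝ} {K : ℕ} (hK : ∀ j, K < j → c ξ j = 0) :
    HasCoeff F ξ K (c ξ K) := by
  have := (h.smooth.isRegular.hasCoeff_zero ξ K).add
    (hasCoeff_sum_pointMass (E := fun η k => D^[k] (delta η)) h.support hK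
      (fun η hη k => hasCoeff_D_iterate_delta_of_ne hη k K)
      (fun k hk => (hasCoeff_D_iterate_delta ξ k).of_lt hk) (hasCoeff_D_iterate_delta ξ K))
  rw [h.eq]
  simpa using this

/-- The order bounds the order of the point masses. -/
theorem IsRep.coeff_eq_zero_of_ord_le {S : Finset ℝ} {N : ℕ} {f : ℝ → ℂ} {c : ℝ → ℕ → ℂ}
    {F : Distr} (h : IsRep S N f c F) {m : ℕ} (hm : ord F ≤ m) (ξ : ℝ) {k : ℕ} (hk : m ≤ k) :
    c ξ k = 0 := by
  have hne : {m : ℕ∞ | ∃ n : ℕ, m = n ∧ ∃ R : Distr, IsRegular R ∧ F = D^[n] R}.Nonempty := by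
    by_contra hcon
    rw [ord, not_nonempty_iff_eq_empty.1 hcon, sInf_empty] at hm
    exact absurd (top_le_iff.1 hm) (ENat.natCast_ne_top m)
  obtain ⟨n, hn, R, hR, hFR⟩ := csInf_mem hne
  have hnm : n ≤ m := by
    have : (n : ℕ∞) ≤ m := hn ▸ hm
    exact_mod_cast this
  have hcoeff : ∀ k, m ≤ k → HasCoeff F ξ k 0 := fun k hk => by
    have := (hR.hasCoeff_zero ξ (k - n)).D_iterate n
    rwa [Nat.sub_add_cancel (hnm.trans hk), ← hFR] at this
  -- descending induction on `k`, starting from `N`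
  have key : ∀ i k, m ≤ k → N ≤ k + i → c ξ k = 0 := by
    intro i
    induction i with
    | zero =>
      intro k _ hk
      by_contra hcon
      exact absurd (h.support ξ k hcon).2 (by lia)
    | succ i ih =>
      intro k hmk hk
      exact (h.hasCoeff fun j hj => ih j (by lia) (by lia)).unique (hcoeff k hmk)
  exact key N k hk (by lia)

theorem ord_D_iterate_le {R : Distr} (hR : IsRegular R) (n : ℕ) : ord (D^[n] R) ≤ n :=
  sInf_le ⟨n, rfl, R, hR, rfl⟩

/-- Near `ξ`, the function part of `F` has the one-sided limits `l` and `r`, the coefficient of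
`δ_ξ⁽ᴷ⁾` in `F` is `v`, and there is no point mass of higher order at `ξ`. -/
def HasLocalData (F : Distr) (ξ : ℝ) (K : ℕ) (v l r : ℂ) : Prop :=
  ∃ (S : Finset ℝ) (N : ℕ) (f : ℝ → ℂ) (c : ℝ → ℕ → ℂ), IsRep S N f c F ∧ c ξ K = v ∧
    (∀ j, K < j → c ξ j = 0) ∧ leftJet f ξ 0 = l ∧ rightJet f ξ 0 = r

/-- The leading coefficient of `F * G`: a leading mass of `F` is multiplied by `G(ξ⁺)`, a leading
mass of `G` by `F(ξ⁻)`. -/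
theorem HasLocalData.hasCoeff_starProd {F G : Distr} {ξ : ℝ} {K : ℕ} {v l r v' l' r' : ℂ}
    (hF : HasLocalData F ξ K v l r) (hG : HasLocalData G ξ K v' l' r') :
    HasCoeff (starProd F G) ξ K (v * r' + v' * l) := by
  obtain ⟨S, N, f, c, hF, rfl, hcK, rfl, rfl⟩ := hF
  obtain ⟨T, M, g, d, hG, rfl, hdK, rfl, rfl⟩ := hG
  rw [(isStarProd_limitProd hF hG).starProd_eq, limitProd]
  have hreg : IsRegular (ofFun fun x => f x * g x) :=
    ⟨_, (hF.smooth.regulated_zero.mul hG.smooth.regulated_zero).locallyIntegrable, rfl⟩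
  have := ((hreg.hasCoeff_zero ξ K).add
    (hasCoeff_sum_pointMass (E := fun η k => deltaProd (rightJet g η) η k) hF.support hcK
      (fun η hη k => hasCoeff_deltaProd_of_ne _ hη k K)
      (fun k hk => (hasCoeff_deltaProd _ ξ k).of_lt hk) (hasCoeff_deltaProd _ ξ K))).add
    (hasCoeff_sum_pointMass (E := fun η k => deltaProd (leftJet f η) η k) hG.support hdK
      (fun η hη k => hasCoeff_deltaProd_of_ne _ hη k K)
      (fun k hk => (hasCoeff_deltaProd _ ξ k).of_lt hk) (hasCoeff_deltaProd _ ξ K))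
  simpa using this

/-! ### One-sided values -/

theorem exists_Icc_subset_of_mem_nhds {ξ : ℝ} {s : Set ℝ} (hs : s ∈ 𝓝 ξ) :
    ∃ δ > 0, Icc (ξ - δ) (ξ + δ) ⊆ s := by
  obtain ⟨δ, hδ, h⟩ := Metric.nhds_basis_closedBall.mem_iff.1 hs
  exact ⟨δ, hδ, by rwa [← Real.closedBall_eq_Icc]⟩

namespace IsRep

variable {S : Finset ℝ} {N : ℕ} {f : ℝ → ℂ} {c : ℝ → ℕ → ℂ} {F : Distr}

theorem exists_punctured (S : Finset ℝ) (ξ : ℝ) :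
    ∃ δ > 0, ∀ x ∈ Icc (ξ - δ) (ξ + δ), x ≠ ξ → x ∉ S := by
  classical
  have h0 : ((S.erase ξ : Finset ℝ) : Set ℝ)ᶜ ∈ 𝓝 ξ :=
    (IsRegulated.isOpen_compl _).mem_nhds (by simp)
  obtain ⟨δ, hδ, h⟩ := exists_Icc_subset_of_mem_nhds h0
  exact ⟨δ, hδ, fun x hx hne hxS => h hx (by simpa using ⟨hxS, hne⟩)⟩

theorem hasLeftValue (h : IsRep S N f c F) (ξ : ℝ) : HasLeftValue F ξ (leftJet f ξ 0) := by
  obtain ⟨δ, hδ, hS⟩ := exists_punctured S ξ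
  exact ⟨δ, hδ, f, h.isSmoothFunOn.mono fun x hx => hS x ⟨hx.1.le, by linarith [hx.2]⟩ hx.2.ne,
    h.smooth.tendsto_leftJet_zero ξ⟩

theorem hasRightValue (h : IsRep S N f c F) (ξ : ℝ) : HasRightValue F ξ (rightJet f ξ 0) := by
  obtain ⟨δ, hδ, hS⟩ := exists_punctured S ξ
  exact ⟨δ, hδ, f, h.isSmoothFunOn.mono fun x hx => hS x ⟨by linarith [hx.1], hx.2.le⟩ hx.1.ne',
    h.smooth.tendsto_rightJet_zero ξ⟩

end IsRep

theorem HasLeftValue.unique {F : Distr} {x : ℝ} {v v' : ℂ} (h : HasLeftValue F x v)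
    (h' : HasLeftValue F x v') : v = v' := by
  obtain ⟨δ, hδ, f, hf, hfv⟩ := h
  obtain ⟨ε, hε, g, hg, hgv⟩ := h'
  let W : Opens ℝ := ⟨Ioo (x - min δ ε) x, isOpen_Ioo⟩
  have hfg := (hf.mono (V := W) (Ioo_subset_Ioo_left (by linarith [min_le_left δ ε]))).eqOn
    (hg.mono (V := W) (Ioo_subset_Ioo_left (by linarith [min_le_right δ ε])))
  refine tendsto_nhds_unique (hfv.congr' ?_) hgv
  filter_upwards [Ioo_mem_nhdsLT (show x - min δ ε < x by simp [hδ, hε])] with y hy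
  exact hfg hy

theorem HasRightValue.unique {F : Distr} {x : ℝ} {v v' : ℂ} (h : HasRightValue F x v)
    (h' : HasRightValue F x v') : v = v' := by
  obtain ⟨δ, hδ, f, hf, hfv⟩ := h
  obtain ⟨ε, hε, g, hg, hgv⟩ := h'
  let W : Opens ℝ := ⟨Ioo x (x + min δ ε), isOpen_Ioo⟩
  have hfg := (hf.mono (V := W) (Ioo_subset_Ioo_right (by simp))).eqOn
    (hg.mono (V := W) (Ioo_subset_Ioo_right (by simp)))
  refine tendsto_nhds_unique (hfv.congr' ?_) hgv
  filter_upwards [Ioo_mem_nhdsGT (show x < x + min δ ε by simp [hδ, hε])] with y hy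
  exact hfg hy

theorem IsSmoothFunOn.hasLeftValue {F : Distr} {g : ℝ → ℂ} {U : Opens ℝ}
    (h : IsSmoothFunOn F g U) {x : ℝ} (hx : x ∈ U) : HasLeftValue F x (g x) := by
  obtain ⟨δ, hδ, hU⟩ := exists_Icc_subset_of_mem_nhds (U.isOpen.mem_nhds hx)
  exact ⟨δ, hδ, g, h.mono fun y hy => hU ⟨hy.1.le, by linarith [hy.2]⟩,
    ((h.1.continuousOn.continuousAt (U.isOpen.mem_nhds hx)).tendsto).mono_left nhdsWithin_le_nhds⟩

theorem IsSmoothFunOn.hasRightValue {F : Distr} {g : ℝ → ℂ} {U : Opens ℝ}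
    (h : IsSmoothFunOn F g U) {x : ℝ} (hx : x ∈ U) : HasRightValue F x (g x) := by
  obtain ⟨δ, hδ, hU⟩ := exists_Icc_subset_of_mem_nhds (U.isOpen.mem_nhds hx)
  exact ⟨δ, hδ, g, h.mono fun y hy => hU ⟨by linarith [hy.1], hy.2.le⟩,
    ((h.1.continuousOn.continuousAt (U.isOpen.mem_nhds hx)).tendsto).mono_left nhdsWithin_le_nhds⟩

theorem isClosed_singSupp (F : Distr) : IsClosed (singSupp F) :=
  (isOpen_biUnion fun U _ => U.isOpen).isClosed_compl

theorem exists_isSmoothFunOn_of_notMem_singSupp {F : Distr} {x : ℝ} (h : x ∉ singSupp F) :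
    ∃ U : Opens ℝ, ∃ g, x ∈ U ∧ IsSmoothFunOn F g U := by
  simp only [singSupp, mem_compl_iff, not_not, mem_iUnion, mem_ofPred_eq] at h
  obtain ⟨U, ⟨g, hg⟩, hx⟩ := h
  exact ⟨U, g, hx, hg⟩

theorem isClosed_singularSet (a₀ a₁ b₀ b₁ : Distr) (w : ℂ) :
    IsClosed (singularSet a₀ a₁ b₀ b₁ w) :=
  (Set.Finite.isClosed_biUnion (Finset.finite_toSet _) fun _ _ =>
    (isClosed_singSupp _).union (isClosed_singSupp _)).union
      ((isClosed_singSupp _).union (isClosed_singSupp _))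

/-- The two conditions say that `a₀(ξ⁻) + a₁(ξ⁺) ≠ 0` at every point. -/
theorem leftValue_add_rightValue_ne_zero {a₀ a₁ b₀ b₁ : Distr} {w : ℂ}
    (hC1 : CondC1 a₀ a₁ (singularSet a₀ a₁ b₀ b₁ w))
    (hC2 : CondC2 a₀ a₁ (singularSet a₀ a₁ b₀ b₁ w)) {ξ : ℝ} {v₀ v₁ : ℂ}
    (h₀ : HasLeftValue a₀ ξ v₀) (h₁ : HasRightValue a₁ ξ v₁) : v₀ + v₁ ≠ 0 := by
  by_cases hξ : ξ ∈ singularSet a₀ a₁ b₀ b₁ w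
  · exact hC1 ξ hξ v₀ v₁ h₀ h₁
  have hs : ξ ∉ singSupp a₀ ∧ ξ ∉ singSupp a₁ := by
    have h0 : singSupp a₀ ∪ singSupp a₁ ⊆ singularSet a₀ a₁ b₀ b₁ w :=
      (subset_biUnion_of_mem (u := fun i => singSupp (D^[i] a₀) ∪ singSupp (D^[i] a₁))
        (show 0 ∈ (Finset.range 3 : Set ℕ) by simp)).trans subset_union_left
    exact ⟨fun h => hξ (h0 (Or.inl h)), fun h => hξ (h0 (Or.inr h))⟩
  obtain ⟨U₀, g₀, hx₀, hg₀⟩ := exists_isSmoothFunOn_of_notMem_singSupp hs.1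
  obtain ⟨U₁, g₁, hx₁, hg₁⟩ := exists_isSmoothFunOn_of_notMem_singSupp hs.2
  obtain ⟨δ, hδ, hsub⟩ := exists_Icc_subset_of_mem_nhds (inter_mem (inter_mem
    (U₀.isOpen.mem_nhds hx₀) (U₁.isOpen.mem_nhds hx₁)) ((isClosed_singularSet a₀ a₁ b₀ b₁ w).isOpen_compl.mem_nhds hξ))
  let V : Opens ℝ := ⟨Ioo (ξ - δ) (ξ + δ), isOpen_Ioo⟩
  have hV : closure (V : Set ℝ) = Icc (ξ - δ) (ξ + δ) := closure_Ioo (by linarith)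
  have hVs : (V : Set ℝ) ⊆ Icc (ξ - δ) (ξ + δ) := Ioo_subset_Icc_self
  have key := hC2 V ordConnected_Ioo
    (disjoint_left.2 fun x hx hxI => (hsub (hVs hx)).2 hxI) g₀ g₁
    ⟨hg₀.mono fun x hx => (hsub (hVs hx)).1.1,
      hg₀.1.mono fun x hx => (hsub (hV ▸ hx)).1.1⟩
    ⟨hg₁.mono fun x hx => (hsub (hVs hx)).1.2,
      hg₁.1.mono fun x hx => (hsub (hV ▸ hx)).1.2⟩ ξ
    (by rw [hV]; constructor <;> linarith)
  rwa [h₀.unique (hg₀.hasLeftValue hx₀), h₁.unique (hg₁.hasRightValue hx₁)]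

/-! ### The leading coefficient of the equation -/

theorem IsRep.hasLocalData_of_ord_le {S : Finset ℝ} {N : ℕ} {f : ℝ → ℂ} {c : ℝ → ℕ → ℂ}
    {F : Distr} (h : IsRep S N f c F) {K i : ℕ} (hord : ord (D^[i] F) ≤ K) (ξ : ℝ) :
    HasLocalData F ξ K 0 (leftJet f ξ 0) (rightJet f ξ 0) := by
  have key : ∀ j, K ≤ j → c ξ j = 0 := by
    induction i generalizing S N f c F with
    | zero => exact fun j hj => h.coeff_eq_zero_of_ord_le hord ξ hj
    | succ i ih => exact fun j hj => ih h.deriv hord (j + 1) (by lia)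
  exact ⟨S, N, f, c, h, key K le_rfl, fun j hj => key j hj.le, rfl, rfl⟩

theorem exists_hasLocalData_of_ord_le {F : Distr} (hF : F ∈ A) {K i : ℕ}
    (hord : ord (D^[i] F) ≤ K) (ξ : ℝ) : ∃ l r, HasLocalData F ξ K 0 l r := by
  obtain ⟨S, N, f, c, h⟩ := exists_isRep hF
  exact ⟨_, _, h.hasLocalData_of_ord_le hord ξ⟩

theorem D_iterate_mem_A {F : Distr} (hF : F ∈ A) (i : ℕ) : D^[i] F ∈ A := by
  obtain ⟨G, hG, n, rfl⟩ := hF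
  exact ⟨G, hG, i + n, (Function.iterate_add_apply D i n G).symm⟩

/-- The leading point masses of `D^[n + 1] g` are the jumps of `g`. -/
theorem exists_isRep_D_iterate_ofFun {S : Finset ℝ} {g : ℝ → ℂ} (hg : IsSmoothOff S g) (n : ℕ) :
    ∃ f c, IsRep S (n + 1) f c (D^[n + 1] (ofFun g)) ∧ ∀ ξ ∈ S, c ξ n = jump g ξ := by
  induction n with
  | zero => exact ⟨_, _, (IsRep.ofFun hg).deriv, fun ξ hξ => by simp [derivCoeff, hξ]⟩
  | succ n ih =>
    obtain ⟨f, c, h, hc⟩ := ih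
    rw [Function.iterate_succ_apply']
    exact ⟨_, _, h.deriv, fun ξ hξ => hc ξ hξ⟩

theorem exists_hasLocalData_D_iterate_ofFun {S : Finset ℝ} {g : ℝ → ℂ} (hg : IsSmoothOff S g)
    {n K : ℕ} (hn : n ≤ K + 1) {ξ : ℝ} (hξ : ξ ∈ S) :
    ∃ l r, HasLocalData (D^[n] (ofFun g)) ξ K (if n = K + 1 then jump g ξ else 0) l r := by
  cases n with
  | zero => exact ⟨_, _, S, 0, g, 0, IsRep.ofFun hg, by simp, by simp, rfl, rfl⟩
  | succ n =>
    obtain ⟨f, c, h, hc⟩ := exists_isRep_D_iterate_ofFun hg n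
    have h0 : ∀ j, n < j → c ξ j = 0 := fun j hj => by
      by_contra hcon
      exact absurd (h.support ξ j hcon).2 (by lia)
    refine ⟨_, _, S, _, f, c, h, ?_, fun j hj => h0 j (by lia), rfl, rfl⟩
    split_ifs with hnK
    · obtain rfl : n = K := by lia
      exact hc ξ hξ
    · exact h0 K (by lia)

/-- If a solution is `D^[n + 1] g` with `g` piecewise smooth and all coefficients have order at
most `n + 4`, then the only contributions of order `n + 4` at a point `ξ` come from the terms
`a₀ * φ⁗` and `φ⁗ * a₁`, and `g` has no jump. -/
theorem jump_eq_zero_of_isSolution {a₀ a₁ b₀ b₁ : Distr} {w : ℂ}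
    (ha₀ : a₀ ∈ A) (ha₁ : a₁ ∈ A) (hb₀ : b₀ ∈ A) (hb₁ : b₁ ∈ A)
    (hC1 : CondC1 a₀ a₁ (singularSet a₀ a₁ b₀ b₁ w))
    (hC2 : CondC2 a₀ a₁ (singularSet a₀ a₁ b₀ b₁ w))
    {S : Finset ℝ} {g : ℝ → ℂ} (hg : IsSmoothOff S g) {n : ℕ}
    (hsol : IsSolution a₀ a₁ b₀ b₁ w (D^[n + 1] (ofFun g)))
    (hM : maxOrd a₀ a₁ b₀ b₁ ≤ (n + 4 : ℕ)) {ξ : ℝ} (hξ : ξ ∈ S) : jump g ξ = 0 := by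
  simp only [maxOrd, max_le_iff] at hM
  obtain ⟨⟨hM₀, hM₁⟩, hN₀, hN₁⟩ := hM
  obtain ⟨S₀, N₀, f₀, c₀, hr₀⟩ := exists_isRep ha₀
  obtain ⟨S₁, N₁, f₁, c₁, hr₁⟩ := exists_isRep ha₁
  have h00 := hr₀.hasLocalData_of_ord_le hM₀ ξ
  have h10 := hr₁.hasLocalData_of_ord_le hM₁ ξ
  obtain ⟨l01, r01, h01⟩ := exists_hasLocalData_of_ord_le (D_iterate_mem_A ha₀ 1) (i := 1) hM₀ ξ
  obtain ⟨l11, r11, h11⟩ := exists_hasLocalData_of_ord_le (D_iterate_mem_A ha₁ 1) (i := 1) hM₁ ξ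
  obtain ⟨l02, r02, h02⟩ := exists_hasLocalData_of_ord_le (D_iterate_mem_A ha₀ 2) (i := 0) hM₀ ξ
  obtain ⟨l12, r12, h12⟩ := exists_hasLocalData_of_ord_le (D_iterate_mem_A ha₁ 2) (i := 0) hM₁ ξ
  obtain ⟨lb0, rb0, hb0⟩ := exists_hasLocalData_of_ord_le hb₀ (i := 0) hN₀ ξ
  obtain ⟨lb1, rb1, hb1⟩ := exists_hasLocalData_of_ord_le hb₁ (i := 0) hN₁ ξ
  have hφ : ∀ i, i ≤ 4 → ∃ l r, HasLocalData (D^[i] (D^[n + 1] (ofFun g))) ξ (n + 4)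
      (if i = 4 then jump g ξ else 0) l r := fun i hi => by
    obtain ⟨l, r, h⟩ := exists_hasLocalData_D_iterate_ofFun hg (n := i + (n + 1)) (K := n + 4)
      (by lia) hξ
    rw [Function.iterate_add_apply] at h
    refine ⟨l, r, ?_⟩
    have hi4 : i = 4 ↔ i + (n + 1) = n + 4 + 1 := by lia
    simpa only [hi4] using h
  obtain ⟨l4, r4, h4⟩ := hφ 4 (by lia)
  obtain ⟨l3, r3, h3⟩ := hφ 3 (by lia)
  obtain ⟨l2, r2, h2⟩ := hφ 2 (by lia)
  obtain ⟨l0, r0, h0⟩ := hφ 0 (by lia)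
  have hop := (((((h00.hasCoeff_starProd h4).add (h4.hasCoeff_starProd h10)).smul 1).add
    (((h01.hasCoeff_starProd h3).add (h3.hasCoeff_starProd h11)).smul 2)).add
    (((h02.hasCoeff_starProd h2).add (h2.hasCoeff_starProd h12)).smul 1)).sub
    (((hb0.hasCoeff_starProd h0).add (h0.hasCoeff_starProd hb1)).smul (w ^ 2))
  have heq : eigenOp a₀ a₁ b₀ b₁ w (D^[n + 1] (ofFun g)) = 0 := hsol.2
  simp only [eigenOp, Finset.sum_range_succ, Finset.sum_range_zero, zero_add] at heq
  norm_num [Nat.choose] at heq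
  have hzero := hop.unique (v' := 0) ?_
  · have hne := leftValue_add_rightValue_ne_zero hC1 hC2 (hr₀.hasLeftValue ξ) (hr₁.hasRightValue ξ)
    have : jump g ξ * (leftJet f₀ ξ 0 + rightJet f₁ ξ 0) = 0 := by
      norm_num at hzero
      linear_combination hzero
    exact (mul_eq_zero.1 this).resolve_right hne
  · convert HasCoeff.zero (ξ := ξ) (K := n + 4) using 1
    simpa using heq

/-- If a piecewise smooth function has no jump, then its distributional derivative is again
piecewise smooth. -/
theorem IsSmoothOff.D_mem_Cp {S : Finset ℝ} {g : ℝ → ℂ} (hg : IsSmoothOff S g)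
    (h : ∀ ξ ∈ S, jump g ξ = 0) : D (ofFun g) ∈ Cp := by
  refine ⟨_root_.deriv g, hg.deriv.isPiecewiseSmooth, ?_⟩
  rw [D_ofFun hg, Finset.sum_eq_zero fun ξ hξ => by rw [h ξ hξ, zero_smul_distr], add_zero]

/-- A solution is an `n`-th derivative of a piecewise smooth function, where `n = 0` or
`n + 3` is less than the maximal order of the coefficients. -/
theorem IsSolution.exists_eq_D_iterate {a₀ a₁ b₀ b₁ : Distr} {w : ℂ}
    (ha₀ : a₀ ∈ A) (ha₁ : a₁ ∈ A) (hb₀ : b₀ ∈ A) (hb₁ : b₁ ∈ A)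
    (hC1 : CondC1 a₀ a₁ (singularSet a₀ a₁ b₀ b₁ w))
    (hC2 : CondC2 a₀ a₁ (singularSet a₀ a₁ b₀ b₁ w)) {φ : Distr}
    (hsol : IsSolution a₀ a₁ b₀ b₁ w φ) :
    ∃ G ∈ Cp, ∃ n : ℕ, φ = D^[n] G ∧ (n = 0 ∨ ((n + 3 : ℕ) : ℕ∞) < maxOrd a₀ a₁ b₀ b₁) := by
  classical
  have hex : ∃ n : ℕ, ∃ G ∈ Cp, φ = D^[n] G := by
    obtain ⟨G, hG, n, h⟩ := hsol.1
    exact ⟨n, G, hG, h⟩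
  obtain ⟨G, hG, hφ⟩ := Nat.find_spec hex
  have hmin : ∀ m < Nat.find hex, ¬∃ G ∈ Cp, φ = D^[m] G := fun m => Nat.find_min hex
  revert hφ hmin
  generalize Nat.find hex = n
  intro hφ hmin
  refine ⟨G, hG, n, hφ, ?_⟩
  cases n with
  | zero => exact Or.inl rfl
  | succ k =>
  refine Or.inr (lt_of_not_ge fun hM => ?_)
  obtain ⟨g, hg, rfl⟩ := hG
  obtain ⟨S, hS⟩ := hg.exists_isSmoothOff
  refine hmin k (Nat.lt_succ_self k) ⟨D (ofFun g), hS.D_mem_Cp fun ξ hξ => ?_, ?_⟩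
  · subst hφ
    exact jump_eq_zero_of_isSolution ha₀ ha₁ hb₀ hb₁ hC1 hC2 hS hsol
      hM hξ
  · rw [hφ, Function.iterate_succ_apply]

theorem isRegular_of_mem_Cp {G : Distr} (hG : G ∈ Cp) : IsRegular G := by
  obtain ⟨g, hg, rfl⟩ := hG
  obtain ⟨S, hS⟩ := hg.exists_isSmoothOff
  exact hS.isRegular

end

end BeamODE

open BeamODE
theorem corollary3p1 (a₀ a₁ b₀ b₁ : Distr) (w : ℂ)
    (ha₀ : a₀ ∈ A) (ha₁ : a₁ ∈ A) (hb₀ : b₀ ∈ A) (hb₁ : b₁ ∈ A)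
    (hC1 : CondC1 a₀ a₁ (singularSet a₀ a₁ b₀ b₁ w))
    (hC2 : CondC2 a₀ a₁ (singularSet a₀ a₁ b₀ b₁ w)) :
    (maxOrd a₀ a₁ b₀ b₁ ≤ 4 →
      ∀ φ : Distr, IsSolution a₀ a₁ b₀ b₁ w φ → ord φ = 0 ∧ φ ∈ Cp) ∧
    (4 < maxOrd a₀ a₁ b₀ b₁ →
      ∀ φ : Distr, IsSolution a₀ a₁ b₀ b₁ w φ → ord φ ≤ maxOrd a₀ a₁ b₀ b₁ - 4) := by
  refine ⟨fun hM φ hsol => ?_, fun hM φ hsol => ?_⟩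
  · obtain ⟨G, hG, n, rfl, hn⟩ := hsol.exists_eq_D_iterate ha₀ ha₁ hb₀ hb₁ hC1 hC2
    obtain rfl : n = 0 := by
      refine hn.elim id fun h => ?_
      have h' : ((n + 3 : ℕ) : ℕ∞) < (4 : ℕ) := h.trans_le hM
      have : n + 3 < 4 := by exact_mod_cast h'
      lia
    exact ⟨nonpos_iff_eq_zero.1 (ord_D_iterate_le (isRegular_of_mem_Cp hG) 0), hG⟩
  · obtain ⟨G, hG, n, rfl, hn⟩ := hsol.exists_eq_D_iterate ha₀ ha₁ hb₀ hb₁ hC1 hC2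
    refine (ord_D_iterate_le (isRegular_of_mem_Cp hG) n).trans ?_
    rcases hn with rfl | hn
    · simp
    · generalize maxOrd a₀ a₁ b₀ b₁ = M at hn ⊢
      induction M using ENat.recTopCoe with
      | top => simp
      | coe M =>
        have h : n + 3 < M := by exact_mod_cast hn
        have h' : n ≤ M - 4 := by lia
        exact_mod_cast h'
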